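/- Theorem. Consider the following heuristic, whose input is a co-chordal graph $G=(V,E)$, i.e. a finite simple graph whose complement $G^c=(V,E^c)$ is chordal (has no induced cycle of length greater than $3$). It finds a perfect elimination ordering $\sigma$ of $G^c$ (an ordering of $V$ in which, for every vertex $v$, the neighbours of $v$ in $G^c$ that come after $v$ form a clique of $G^c$), and sets $G'\leftarrow G^c$, $S\leftarrow V$, $\mathrm{bp}\leftarrow\emptyset$. While $S\neq\emptyset$: let $v$ be the first element of $S$ in the ordering $\sigma$, let $L=S\setminus(\{v\}\cup N_{G'}(v))$ and $R=\{v\}\cup\{u\in N_{G'}(v): N_{G'}(u)\cap L=\emptyset\}$; if $L\ne\emptyset$, add the biclique $\{L,R\}$ to $\mathrm{bp}$; replace $S$ by $S\setminus R$ and delete the vertices of $R$ from $G'$. It returns $\mathrm{bp}$. This heuristic can be implemented to run in $O\bigl(|V|(|V|+|E^c|)\bigr)$ time. Precisely: on a unit-cost random access machine with arithmetic restricted to constants, successor and truncated subtraction, there are one program of the form "prep; while $b$ do body" and one constant $C$ such that, for every co-chordal graph $G$ on $V=\{0,\dots,|V|-1\}$ given by its adjacency matrix, the program carries out the heuristic for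 some perfect elimination ordering $\sigma$ of $G^c$: after prep, and after each iteration of the while loop, the memory holds $\sigma$ and the current $S$ and $\mathrm{bp}$ of the heuristic; each execution of body performs exactly one iteration of the heuristic's loop, in at most $C(|V|+|E^c|)$ steps; and the whole program halts after at most $C\,(|V|(|V|+|E^c|)+1)$ steps, with the returned $\mathrm{bp}$ in memory. This $\mathrm{bp}$ is a biclique partition of $G$: each of its members is a biclique subgraph of $G$, and every edge of $G$ lies in exactly one of them. -/

import Mathlib

/-! ### The machine model

A unit-cost random access machine, programmed in structured form.  The memory consists of
registers `reg x` and arrays `arr a`, all holding natural numbers; a program mentions only finitely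
many registers and arrays.  Arithmetic is restricted to constants, successor and truncated
subtraction, so that after `t` steps every number in memory is at most `t` plus the maximum of the
input numbers and the constants of the program: words of logarithmic length suffice, and nothing can
be gained by packing data into large numbers.
Every operation (including every operator inside an expression) costs one step. -/

/-- The memory of the machine. -/
structure RamStore where
  reg : ℕ → ℕ
  arr : ℕ → ℕ → ℕ

/-- Expressions: constants, registers, successor, truncated subtraction, array access. -/
inductive RamExp where
  | const (c : ℕ)
  | reg (x : ℕ)
  | succ (e : RamExp)
  | sub (e f : RamExp)
  | get (a : ℕ) (e : RamExp)

namespace RamExp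

/-- The value of an expression. -/
def eval (s : RamStore) : RamExp → ℕ
  | const c => c
  | reg x => s.reg x
  | succ e => e.eval s + 1
  | sub e f => e.eval s - f.eval s
  | get a e => s.arr a (e.eval s)

/-- The number of steps needed to evaluate an expression. -/
def cost : RamExp → ℕ
  | const _ => 1
  | reg _ => 1
  | succ e => e.cost + 1
  | sub e f => e.cost + f.cost + 1
  | get _ e => e.cost + 1

end RamExp

/-- Tests: comparisons of two expressions. -/
inductive RamTest where
  | lt (e f : RamExp)
  | eq (e f : RamExp)

namespace RamTest

/-- The truth of a test. -/
def Holds (s : RamStore) : RamTest → Prop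
  | lt e f => e.eval s < f.eval s
  | eq e f => e.eval s = f.eval s

/-- The number of steps needed to evaluate a test. -/
def cost : RamTest → ℕ
  | lt e f => e.cost + f.cost + 1
  | eq e f => e.cost + f.cost + 1

end RamTest

/-- Programs: `skip`, assignment to a register, assignment to an array cell (`put a e f` sets cell
`e` of array `a` to `f`), sequential composition, branching, and while loops. -/
inductive RamProg where
  | skip
  | set (x : ℕ) (e : RamExp)
  | put (a : ℕ) (e f : RamExp)
  | seq (p q : RamProg)
  | cond (b : RamTest) (p q : RamProg)
  | loop (b : RamTest) (p : RamProg)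

/-- `RamExec p s s' t`: the program `p`, started with memory `s`, halts after exactly `t` steps with
memory `s'`. -/
inductive RamExec : RamProg → RamStore → RamStore → ℕ → Prop
  | skip (s : RamStore) : RamExec .skip s s 1
  | set (x : ℕ) (e : RamExp) (s : RamStore) :
      RamExec (.set x e) s ⟨Function.update s.reg x (e.eval s), s.arr⟩ (e.cost + 1)
  | put (a : ℕ) (e f : RamExp) (s : RamStore) :
      RamExec (.put a e f) s
        ⟨s.reg, Function.update s.arr a (Function.update (s.arr a) (e.eval s) (f.eval s))⟩
        (e.cost + f.cost + 1)
  | seq {p q : RamProg} {s s₁ s₂ : RamStore} {t₁ t₂ : ℕ}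
      (h₁ : RamExec p s s₁ t₁) (h₂ : RamExec q s₁ s₂ t₂) : RamExec (.seq p q) s s₂ (t₁ + t₂)
  | cond_true {b : RamTest} {p q : RamProg} {s s₁ : RamStore} {t : ℕ}
      (hb : b.Holds s) (h : RamExec p s s₁ t) : RamExec (.cond b p q) s s₁ (b.cost + t)
  | cond_false {b : RamTest} {p q : RamProg} {s s₁ : RamStore} {t : ℕ}
      (hb : ¬ b.Holds s) (h : RamExec q s s₁ t) : RamExec (.cond b p q) s s₁ (b.cost + t)
  | loop_true {b : RamTest} {p : RamProg} {s s₁ s₂ : RamStore} {t₁ t₂ : ℕ}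
      (hb : b.Holds s) (h₁ : RamExec p s s₁ t₁) (h₂ : RamExec (.loop b p) s₁ s₂ t₂) :
      RamExec (.loop b p) s s₂ (b.cost + t₁ + t₂)
  | loop_false {b : RamTest} {p : RamProg} {s : RamStore}
      (hb : ¬ b.Holds s) : RamExec (.loop b p) s s b.cost

/-! ### Graph notions -/

/-- A graph is chordal if it has no induced cycle of length greater than three. -/
def IsChordalGraph {V : Type*} (H : SimpleGraph V) : Prop :=
  ∀ k : ℕ, 4 ≤ k → IsEmpty (SimpleGraph.cycleGraph k ↪g H)

/-- The ordering `σ 0, σ 1, …` of the vertices is a perfect elimination ordering: the neighbours of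
`σ i` in the subgraph induced by `{σ j | i ≤ j}` form a clique, for every `i`. -/
def IsPerfectElimination {n : ℕ} {V : Type*} (H : SimpleGraph V) (σ : Fin n ≃ V) : Prop :=
  ∀ i : Fin n, H.IsClique {u | H.Adj (σ i) u ∧ i ≤ σ.symm u}

/-- A list of pairs `(L, R)` is a biclique partition of `G`: each `{L, R}` is a biclique subgraph of
`G`, and every edge of `G` lies in exactly one of them. -/
def IsBicliquePartition {V : Type*} (G : SimpleGraph V) (bp : List (Finset V × Finset V)) : Prop :=
  (∀ B ∈ bp, Disjoint B.1 B.2 ∧ ∀ u ∈ B.1, ∀ v ∈ B.2, G.Adj u v) ∧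
  ∀ u v : V, G.Adj u v → ∃! i : Fin bp.length,
    (u ∈ bp[i].1 ∧ v ∈ bp[i].2) ∨ (v ∈ bp[i].1 ∧ u ∈ bp[i].2)

/-! ### The heuristic -/

/-- The state of the heuristic at the head of its while loop: the set `S` of remaining vertices
(which is also the vertex set of the current graph `G'`) and the bicliques found so far. -/
structure HeuristicState (V : Type*) where
  S : Finset V
  bp : List (Finset V × Finset V)

open Classical in
/-- The neighbourhood of `v` in `G'`, the subgraph of `H` induced by the remaining vertices `S`. -/
noncomputable def nbrsIn {V : Type*} (H : SimpleGraph V) (S : Finset V) (v : V) : Finset V :=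
  S.filter (fun u => H.Adj v u)

open Classical in
/-- `L = S \ ({v} ∪ N_{G'}(v))`. -/
noncomputable def leftPart {V : Type*} (H : SimpleGraph V) (S : Finset V) (v : V) : Finset V :=
  S \ ({v} ∪ nbrsIn H S v)

open Classical in
/-- `R = {v} ∪ {u ∈ N_{G'}(v) | N_{G'}(u) ∩ L = ∅}`. -/
noncomputable def rightPart {V : Type*} (H : SimpleGraph V) (S : Finset V) (v : V) : Finset V :=
  {v} ∪ (nbrsIn H S v).filter (fun u => nbrsIn H S u ∩ leftPart H S v = ∅)

open Classical in
/-- One iteration of the while loop: take the first vertex `v` of `S` in the ordering `σ`, form `L`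
and `R`, record `{L, R}` if `L` is nonempty, and delete `R`. -/
def HeuristicIteration {n : ℕ} {V : Type*} (H : SimpleGraph V) (σ : Fin n ≃ V)
    (A A' : HeuristicState V) : Prop :=
  ∃ v ∈ A.S, (∀ u ∈ A.S, σ.symm v ≤ σ.symm u) ∧
    A'.S = A.S \ rightPart H A.S v ∧
    A'.bp = if leftPart H A.S v = ∅ then A.bp
      else A.bp ++ [(leftPart H A.S v, rightPart H A.S v)]

/-- `IsHeuristicRun G σ k A`: on input `G`, the heuristic chooses the perfect elimination ordering
`σ` of the complement of `G`, and its while loop ends after exactly `k` iterations, passing through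
the states `A 0, …, A k`.  The biclique partition returned is `(A k).bp`. -/
def IsHeuristicRun {n : ℕ} (G : SimpleGraph (Fin n)) (σ : Fin n ≃ Fin n) (k : ℕ)
    (A : ℕ → HeuristicState (Fin n)) : Prop :=
  IsPerfectElimination Gᶜ σ ∧
  A 0 = ⟨Finset.univ, []⟩ ∧
  (∀ i < k, (A i).S ≠ ∅ ∧ HeuristicIteration Gᶜ σ (A i) (A (i + 1))) ∧
  (A k).S = ∅

/-! ### Encodings -/

open Classical in
/-- The input memory: register `0` holds the number `n` of vertices, array `0` holds the adjacency
matrix of `G` row by row, and everything else is zero. -/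
noncomputable def graphInput {n : ℕ} (G : SimpleGraph (Fin n)) : RamStore where
  reg x := if x = 0 then n else 0
  arr a c := if a = 0 ∧ ∃ i j : Fin n, c = (i : ℕ) * n + (j : ℕ) ∧ G.Adj i j then 1 else 0

open Classical in
/-- The memory `s` holds the ordering `σ` and the state `A` of the heuristic: register `1` holds the
number of bicliques found, array `1` holds them as the rows of a matrix (entry `1` for the vertices
in `L`, entry `2` for those in `R`, entry `0` for the others), array `2` holds the indicator function
of `S`, and array `3` the ordering. -/
structure HoldsState {n : ℕ} (σ : Fin n ≃ Fin n) (A : HeuristicState (Fin n)) (s : RamStore) :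
    Prop where
  count : s.reg 1 = A.bp.length
  bicliques : ∀ (i : Fin A.bp.length) (u : Fin n),
    s.arr 1 ((i : ℕ) * n + (u : ℕ)) =
      if u ∈ A.bp[i].1 then 1 else if u ∈ A.bp[i].2 then 2 else 0
  remaining : ∀ u : Fin n, s.arr 2 u = if u ∈ A.S then 1 else 0
  order : ∀ i : Fin n, s.arr 3 i = σ i

/-!
The heuristic has two mathematical ingredients and one algorithmic one.

*Ordering.* Number the vertices of the chordal graph `H = Gᶜ` from the last position to the first,
always taking a vertex with the most numbered neighbours. The resulting ordering is a perfect
elimination ordering (`IsMaxCardinalityOrdering.isPerfectElimination`): otherwise some vertex has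
two later, nonadjacent neighbours, hence there is an induced path all of whose inner vertices
precede both ends. Take such a path whose earlier end is as late as possible. By maximality of the
number of neighbours, that end has a later neighbour `x` that is not adjacent to the inner vertex
next to the other end; then `x` either closes an induced cycle of length at least four or begins a
path of the same kind whose earlier end is later (`IsMaxCardinalityOrdering.not_isInducedPath`).

*Partition.* If `v` is the first remaining vertex, then its remaining neighbours form a clique of
`H`. So the edges of `G` that lose an end when `R` is deleted are exactly those between `L` and
`R`, and all pairs between `L` and `R` are edges of `G`. Hence an edge is covered exactly once,
namely in the iteration that deletes the first of its ends (`IsHeuristicRun.isBicliquePartition`).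

*Time.* Adjacency lists of `H` are read off the matrix in time quadratic in `n`, and the search
above also takes quadratic time, since the weights of all vertices can be updated along a row of
the matrix. In an iteration of the heuristic, `L` is found by crossing out the list of `v`, and
`R` by going through all the lists once, which takes time linear in `n` plus the total length
`2 m` of the lists. Each iteration deletes at least the vertex `v`, so that there are at most `n` of
them.

Programs are verified with a weakest-precondition calculus for `RamExec` (`Halts`). Its loop rules
combine an invariant with a potential function that accounts for the running time, and a syntactic
frame property (`RamExec.frame`) supplies everything a program leaves unchanged.
-/

/-! ### A program logic for the machine -/

/-- Sequential composition of programs. -/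
infixr:60 " ;; " => RamProg.seq

namespace RamProg

/-- The registers a program may write to. -/
def regs : RamProg → List ℕ
  | skip => []
  | set x _ => [x]
  | put _ _ _ => []
  | seq p q => p.regs ++ q.regs
  | cond _ p q => p.regs ++ q.regs
  | loop _ p => p.regs

/-- The arrays a program may write to. -/
def arrs : RamProg → List ℕ
  | skip => []
  | set _ _ => []
  | put a _ _ => [a]
  | seq p q => p.arrs ++ q.arrs
  | cond _ p q => p.arrs ++ q.arrs
  | loop _ p => p.arrs

/-- The memories `s` and `s'` differ at most in the registers and arrays that `p` may write to. -/
structure Frame (p : RamProg) (s s' : RamStore) : Prop where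
  reg : ∀ x, x ∉ p.regs → s'.reg x = s.reg x
  arr : ∀ a, a ∉ p.arrs → s'.arr a = s.arr a

theorem Frame.refl (p : RamProg) (s : RamStore) : Frame p s s :=
  ⟨fun _ _ => rfl, fun _ _ => rfl⟩

theorem Frame.trans {p : RamProg} {s₁ s₂ s₃ : RamStore} (h : Frame p s₁ s₂) (h' : Frame p s₂ s₃) :
    Frame p s₁ s₃ :=
  ⟨fun x hx => (h'.reg x hx).trans (h.reg x hx), fun a ha => (h'.arr a ha).trans (h.arr a ha)⟩

theorem Frame.mono {p q : RamProg} {s s' : RamStore} (h : Frame p s s')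
    (hr : ∀ x ∈ p.regs, x ∈ q.regs) (ha : ∀ a ∈ p.arrs, a ∈ q.arrs) : Frame q s s' :=
  ⟨fun x hx => h.reg x fun hx' => hx (hr x hx'), fun a h' => h.arr a fun ha' => h' (ha a ha')⟩

end RamProg

/-- A program changes only what it may write to. -/
theorem RamExec.frame {p : RamProg} {s s' : RamStore} {t : ℕ} (h : RamExec p s s' t) :
    p.Frame s s' := by
  induction h with
  | skip s => exact .refl _ _
  | set x e s =>
    refine ⟨fun y hy => Function.update_of_ne ?_ _ _, fun _ _ => rfl⟩
    simpa [RamProg.regs] using hy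
  | put a e f s =>
    refine ⟨fun _ _ => rfl, fun b hb => Function.update_of_ne ?_ _ _⟩
    simpa [RamProg.arrs] using hb
  | seq _ _ ih₁ ih₂ =>
    exact (ih₁.mono (by simp +contextual [RamProg.regs]) (by simp +contextual [RamProg.arrs])).trans
      (ih₂.mono (by simp +contextual [RamProg.regs]) (by simp +contextual [RamProg.arrs]))
  | cond_true _ _ ih =>
    exact ih.mono (by simp +contextual [RamProg.regs]) (by simp +contextual [RamProg.arrs])
  | cond_false _ _ ih =>
    exact ih.mono (by simp +contextual [RamProg.regs]) (by simp +contextual [RamProg.arrs])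
  | loop_true _ _ _ ih₁ ih₂ => exact RamProg.Frame.trans ⟨ih₁.reg, ih₁.arr⟩ ih₂
  | loop_false _ => exact .refl _ _

/-- The program `p`, started with memory `s`, halts with a memory and after a number of steps that
together satisfy `Q`. -/
def Halts (p : RamProg) (s : RamStore) (Q : RamStore → ℕ → Prop) : Prop :=
  ∃ s' t, RamExec p s s' t ∧ Q s' t

namespace Halts

variable {p q : RamProg} {s : RamStore} {Q Q' : RamStore → ℕ → Prop} {b : RamTest}

theorem mono (h : Halts p s Q) (hQ : ∀ s' t, p.Frame s s' → Q s' t → Q' s' t) : Halts p s Q' :=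
  let ⟨s', t, he, hq⟩ := h
  ⟨s', t, he, hQ s' t he.frame hq⟩

theorem skip (h : Q s 1) : Halts .skip s Q := ⟨_, _, .skip s, h⟩

theorem set {x : ℕ} {e : RamExp}
    (h : Q ⟨Function.update s.reg x (e.eval s), s.arr⟩ (e.cost + 1)) : Halts (.set x e) s Q :=
  ⟨_, _, .set x e s, h⟩

theorem put {a : ℕ} {e f : RamExp}
    (h : Q ⟨s.reg, Function.update s.arr a (Function.update (s.arr a) (e.eval s) (f.eval s))⟩
      (e.cost + f.cost + 1)) : Halts (.put a e f) s Q :=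
  ⟨_, _, .put a e f s, h⟩

theorem seq (h : Halts p s fun s₁ t₁ => Halts q s₁ fun s₂ t₂ => Q s₂ (t₁ + t₂)) :
    Halts (p ;; q) s Q :=
  let ⟨_, _, h₁, _, _, h₂, hQ⟩ := h
  ⟨_, _, .seq h₁ h₂, hQ⟩

theorem cond (h₁ : b.Holds s → Halts p s fun s' t => Q s' (b.cost + t))
    (h₂ : ¬ b.Holds s → Halts q s fun s' t => Q s' (b.cost + t)) : Halts (.cond b p q) s Q := by
  by_cases hb : b.Holds s
  · obtain ⟨_, _, h, hQ⟩ := h₁ hb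
    exact ⟨_, _, .cond_true hb h, hQ⟩
  · obtain ⟨_, _, h, hQ⟩ := h₂ hb
    exact ⟨_, _, .cond_false hb h, hQ⟩

/-- The rule for loops.  The invariant `I k` holds when `k` iterations are still to come, and the
potential `φ k` bounds the number of steps they take. -/
theorem loop (I : ℕ → RamStore → Prop) (φ : ℕ → ℕ) {N : ℕ} (h₀ : I N s)
    (hstep : ∀ k < N, ∀ s', p.Frame s s' → I (k + 1) s' → b.Holds s' ∧
      Halts p s' fun s'' t => b.cost + t + φ k ≤ φ (k + 1) ∧ I k s'')
    (hend : ∀ s', p.Frame s s' → I 0 s' → ¬ b.Holds s') :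
    Halts (.loop b p) s fun s' t => t + φ 0 ≤ φ N + b.cost ∧ I 0 s' := by
  induction N generalizing s with
  | zero => exact ⟨_, _, .loop_false (hend s (.refl _ _) h₀), by omega, h₀⟩
  | succ N ih =>
    obtain ⟨hb, s₁, t₁, he, ht, h₁⟩ := hstep N (by omega) s (.refl _ _) h₀
    obtain ⟨s₂, t₂, he', ht', h₂⟩ := ih h₁
      (fun k hk s' hs' => hstep k (by omega) s' (he.frame.trans hs'))
      (fun s' hs' => hend s' (he.frame.trans hs'))
    exact ⟨_, _, .loop_true hb he he', by omega, h₂⟩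

/-- The rule for loops that count register `x` up to the value of register `y`.  The invariant
`I i` holds when `x` has the value `i`; an increase of the potential `φ` pays for the body and the
test, whose cost is `3`. -/
theorem loop_up {x y : ℕ} (I : ℕ → RamStore → Prop) (φ : ℕ → ℕ) {lo hi : ℕ} (hlo : lo ≤ hi)
    (hx : s.reg x = lo) (hy : s.reg y = hi) (hp : y ∉ p.regs) (h₀ : I lo s)
    (hstep : ∀ i, lo ≤ i → i < hi → ∀ s', p.Frame s s' → s'.reg x = i → I i s' →
      Halts p s' fun s'' t => t + 3 + φ i ≤ φ (i + 1) ∧ s''.reg x = i + 1 ∧ I (i + 1) s'') :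
    Halts (.loop (.lt (.reg x) (.reg y)) p) s fun s' t =>
      t + φ lo ≤ φ hi + 3 ∧ s'.reg x = hi ∧ I hi s' := by
  obtain ⟨d, rfl⟩ := Nat.exists_eq_add_of_le hlo
  induction d generalizing lo s with
  | zero =>
    exact ⟨_, _, .loop_false (by simp [RamTest.Holds, RamExp.eval, hx, hy]),
      by simp [RamTest.cost, RamExp.cost, add_comm], hx, h₀⟩
  | succ d ih =>
    obtain ⟨s₁, t₁, he, ht, hx', h₁⟩ := hstep lo le_rfl (by omega) s (.refl _ _) hx h₀
    have hd : lo + (d + 1) = lo + 1 + d := by omega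
    rw [hd] at hy hstep ⊢
    obtain ⟨s₂, t₂, he', ht', h₂⟩ := ih hx' h₁ (by omega) ((he.frame.reg y hp).trans hy)
      (fun i hi hi' s' hs' => hstep i (by omega) (by omega) s' (he.frame.trans hs'))
    have hb : (RamTest.lt (.reg x) (.reg y)).Holds s := by
      simp only [RamTest.Holds, RamExp.eval, hx, hy]
      omega
    refine ⟨_, _, .loop_true hb he he', ?_, h₂⟩
    simp only [RamTest.cost, RamExp.cost]
    omega

end Halts

/-! ### Maximum cardinality search on chordal graphs -/

/-- `p 0, …, p k` is an induced path of `H`. -/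
def IsInducedPath {V : Type*} (H : SimpleGraph V) (k : ℕ) (p : ℕ → V) : Prop :=
  ∀ i j, i < j → j ≤ k → p i ≠ p j ∧ (H.Adj (p i) (p j) ↔ j = i + 1)

/-- An induced path with at least two edges cannot be closed up to a longer cycle by a vertex
adjacent to exactly its two ends. -/
theorem IsChordalGraph.not_adj_ends {V : Type*} {H : SimpleGraph V} (hH : IsChordalGraph H) {k : ℕ}
    {p : ℕ → V} (hk : 2 ≤ k) (hp : IsInducedPath H k p) {x : V} (hx : ∀ i ≤ k, x ≠ p i)
    (hadj : ∀ i ≤ k, H.Adj x (p i) ↔ i = 0 ∨ i = k) : False := by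
  let c : Fin (k + 2) → V := fun i => if (i : ℕ) = k + 1 then x else p i
  have key : ∀ i j : Fin (k + 2), i < j → c i ≠ c j ∧
      (H.Adj (c i) (c j) ↔ (SimpleGraph.cycleGraph (k + 2)).Adj i j) := by
    intro i j hij
    have hij' : (i : ℕ) < j := hij
    have hj := j.isLt
    have hi : (i : ℕ) ≠ k + 1 := by omega
    have h₁ : (j - i : Fin (k + 2)).val = j - i := Fin.sub_val_of_le hij.le
    have h₂ : (i - j : Fin (k + 2)).val = k + 2 + i - j := by
      rw [Fin.val_sub, Nat.mod_eq_of_lt (by omega)]; omega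
    rw [SimpleGraph.cycleGraph_adj', h₁, h₂]
    simp only [c, hi, if_false]
    split_ifs with hjk
    · refine ⟨(hx i (by omega)).symm, ?_⟩
      rw [H.adj_comm, hadj i (by omega)]
      omega
    · obtain ⟨h, h'⟩ := hp i j hij' (by omega)
      refine ⟨h, h'.trans ?_⟩
      omega
  have hinj : Function.Injective c := by
    intro i j h
    by_contra hne
    rcases lt_or_gt_of_ne hne with hlt | hlt
    · exact (key i j hlt).1 h
    · exact (key j i hlt).1 h.symm
  refine (hH (k + 2) (by omega)).elim' ⟨⟨c, hinj⟩, ?_⟩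
  intro i j
  rcases lt_trichotomy i j with hlt | rfl | hlt
  · exact (key i j hlt).2
  · simp
  · rw [SimpleGraph.adj_comm, SimpleGraph.adj_comm _ i]
    exact (key j i hlt).2

open Classical in
/-- The ordering `σ` can be produced from the last position to the first by maximum cardinality
search: the vertex at position `i` has, among the vertices at positions up to `i`, the largest
number of neighbours at the later positions. -/
def IsMaxCardinalityOrdering {n : ℕ} {V : Type*} (H : SimpleGraph V) (σ : Fin n ≃ V) : Prop :=
  ∀ i j : Fin n, j < i → ((Finset.Ioi i).filter fun q => H.Adj (σ q) (σ j)).card ≤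
    ((Finset.Ioi i).filter fun q => H.Adj (σ q) (σ i)).card

/-- If `σ j` has a neighbour after position `i` that is not adjacent to `σ i`, then `σ i` has one
that is not adjacent to `σ j`. -/
theorem IsMaxCardinalityOrdering.exists_adj_not_adj {n : ℕ} {V : Type*} {H : SimpleGraph V}
    {σ : Fin n ≃ V} (hσ : IsMaxCardinalityOrdering H σ) {j i q : Fin n} (hji : j < i) (hiq : i < q)
    (h₁ : H.Adj (σ q) (σ j)) (h₂ : ¬ H.Adj (σ q) (σ i)) :
    ∃ r, i < r ∧ H.Adj (σ r) (σ i) ∧ ¬ H.Adj (σ r) (σ j) := by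
  classical
  by_contra! h
  refine absurd (hσ i j hji) (not_le.2 (Finset.card_lt_card ?_))
  rw [Finset.ssubset_iff_of_subset]
  · exact ⟨q, by simp [hiq, h₁], by simp [h₂]⟩
  · intro r
    simp only [Finset.mem_filter, Finset.mem_Ioi]
    exact fun ⟨hr, hr'⟩ => ⟨hr, h r hr hr'⟩

/-- In a chordal graph ordered by maximum cardinality search, no induced path with at least two
edges has all its inner vertices before both of its ends: from such a path one obtains another one
whose earlier end is later.  The induction is on the number `m` of positions after the earlier
end. -/
theorem IsMaxCardinalityOrdering.not_isInducedPath {n : ℕ} {V : Type*} {H : SimpleGraph V}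
    {σ : Fin n ≃ V} (hσ : IsMaxCardinalityOrdering H σ) (hH : IsChordalGraph H) (m : ℕ) :
    ∀ (k : ℕ) (p : ℕ → V), 2 ≤ k → n ≤ σ.symm (p 0) + m → σ.symm (p 0) < σ.symm (p k) →
      (∀ i, 0 < i → i < k → σ.symm (p i) < σ.symm (p 0)) → ¬ IsInducedPath H k p := by
  induction m with
  | zero => intro k p _ h; have := (σ.symm (p 0)).isLt; omega
  | succ m ih =>
    intro k p hk hm h0k hint hp
    -- the last inner vertex is adjacent to `p k` and `p 0` is not, so that `p 0` has a later
    -- neighbour not adjacent to the last inner vertex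
    obtain ⟨r, hr, hr₁, hr₂⟩ := hσ.exists_adj_not_adj (hint (k - 1) (by omega) (by omega)) h0k
      (by simpa using ((hp (k - 1) k (by omega) le_rfl).2.2 (by omega)).symm)
      (by
        have := (hp 0 k (by omega) le_rfl).2.not.2 (by omega)
        simpa [H.adj_comm] using this)
    simp only [Equiv.apply_symm_apply] at hr₁ hr₂
    set x := σ r
    have hxr : σ.symm x = r := σ.symm_apply_apply r
    have hxk : ¬ x = p k := by
      intro h
      rw [h] at hr₁
      have := (hp 0 k (by omega) le_rfl).2.1 hr₁.symm
      omega
    have hx : ∀ i ≤ k, x ≠ p i := by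
      intro i hi h
      rcases Nat.eq_zero_or_pos i with rfl | hi0
      · exact hr₁.ne h
      rcases hi.lt_or_eq with hik | rfl
      · have := hint i hi0 hik
        rw [← h, hxr] at this
        exact absurd hr (not_lt.2 this.le)
      · exact hxk h
    -- `j` is the last inner index with `p j` adjacent to `x`
    obtain ⟨j, hj, hjx, hjmax⟩ : ∃ j ≤ k - 2, H.Adj x (p j) ∧
        ∀ i, j < i → i < k → ¬ H.Adj x (p i) := by
      classical
      refine ⟨Nat.findGreatest (fun i => H.Adj x (p i)) (k - 2), Nat.findGreatest_le _,
        Nat.findGreatest_spec (P := fun i => H.Adj x (p i)) (Nat.zero_le _) hr₁, ?_⟩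
      intro i hi hik
      by_cases hik' : i = k - 1
      · rwa [hik']
      · exact Nat.findGreatest_is_greatest hi (by omega)
    have hpj : IsInducedPath H (k - j) fun i => p (j + i) := by
      intro a b hab hb
      have := hp (j + a) (j + b) (by omega) (by omega)
      exact ⟨this.1, this.2.trans (by omega)⟩
    by_cases hxk' : H.Adj x (p k)
    · refine hH.not_adj_ends (by omega) hpj (fun i hi => hx _ (by omega)) fun i hi => ?_
      constructor
      · intro h
        by_contra! hi'
        exact hjmax (j + i) (by omega) (by omega) h
      · rintro (rfl | rfl)
        · exact hjx
        · rwa [Nat.add_sub_cancel' (by omega)]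
    · -- the path `x, p j, …, p k`, followed from its earlier end
      have hq : IsInducedPath H (k - j + 1) fun i => if i = 0 then x else p (j + (i - 1)) := by
        intro a b hab hb
        have hb0 : b ≠ 0 := by omega
        simp only [hb0, if_false]
        split_ifs with ha
        · subst ha
          refine ⟨hx _ (by omega), ?_⟩
          constructor
          · intro h
            by_contra hb1
            by_cases hbk : j + (b - 1) = k
            · exact hxk' (hbk ▸ h)
            · exact hjmax (j + (b - 1)) (by omega) (by omega) h
          · rintro rfl
            exact hjx
        · have := hp (j + (a - 1)) (j + (b - 1)) (by omega) (by omega)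
          exact ⟨this.1, this.2.trans (by omega)⟩
      have hinner : ∀ i, j ≤ i → i < k → σ.symm (p i) ≤ σ.symm (p 0) := by
        intro i _ hik
        rcases Nat.eq_zero_or_pos i with rfl | hi0
        · exact le_rfl
        · exact (hint i hi0 hik).le
      have hlast : j + (k - j + 1 - 1) = k := by omega
      have hlast' : j + (k - j) = k := by omega
      have hr' : (σ.symm (p 0) : ℕ) < r := hr
      have h0k' : (σ.symm (p 0) : ℕ) < σ.symm (p k) := h0k
      rcases lt_trichotomy r (σ.symm (p k)) with hrk | hrk | hrk
      · refine ih (k - j + 1) _ (by omega) ?_ ?_ ?_ hq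
        · simp only [if_true, hxr]; omega
        · simpa [hlast', hxr] using hrk
        · intro i hi hi'
          simp only [hi.ne', if_false, if_true, hxr]
          exact (hinner _ (by omega) (by omega)).trans_lt hr
      · exact hxk (by rw [← hxr, Equiv.symm_apply_eq] at hrk; simpa using hrk)
      · have hq' : IsInducedPath H (k - j + 1)
            fun i => (fun i => if i = 0 then x else p (j + (i - 1))) (k - j + 1 - i) := by
          intro a b hab hb
          have := hq (k - j + 1 - b) (k - j + 1 - a) (by omega) (by omega)
          refine ⟨this.1.symm, ?_⟩
          rw [H.adj_comm, this.2]
          omega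
        refine ih (k - j + 1) _ (by omega) ?_ ?_ ?_ hq'
        · simp only [Nat.sub_zero, Nat.add_one_ne_zero, if_false, hlast]; omega
        · simpa [hlast', hxr] using hrk
        · intro i hi hi'
          have h1 : k - j + 1 - i ≠ 0 := by omega
          simp only [h1, if_false, Nat.sub_zero, hlast, Nat.add_one_ne_zero]
          exact (hinner _ (by omega) (by omega)).trans_lt h0k

theorem IsMaxCardinalityOrdering.isPerfectElimination {n : ℕ} {V : Type*} {H : SimpleGraph V}
    {σ : Fin n ≃ V} (hσ : IsMaxCardinalityOrdering H σ) (hH : IsChordalGraph H) :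
    IsPerfectElimination H σ := by
  -- two later neighbours of `σ i` that are not adjacent are the ends of an induced path through it
  have key : ∀ (i : Fin n) (u v : V), H.Adj (σ i) u → H.Adj (σ i) v → i < σ.symm u →
      σ.symm u < σ.symm v → H.Adj u v := by
    intro i u v hu hv hiu huv
    by_contra hn
    have hne : u ≠ v := by rintro rfl; exact lt_irrefl _ huv
    refine hσ.not_isInducedPath hH n 2
      (fun a => if a = 0 then u else if a = 1 then σ i else v) le_rfl (by simp) (by simpa using huv)
      ?_ ?_
    · intro a ha ha'
      obtain rfl : a = 1 := by omega
      simpa using hiu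
    · intro a b hab hb
      obtain ⟨rfl, rfl⟩ | ⟨rfl, rfl⟩ | ⟨rfl, rfl⟩ :
          (a = 0 ∧ b = 1) ∨ (a = 0 ∧ b = 2) ∨ (a = 1 ∧ b = 2) := by omega
      · simp [hu.symm, hu.symm.ne]
      · simp [hn, hne]
      · simp [hv, hv.ne]
  have hlt : ∀ {i : Fin n} {u : V}, H.Adj (σ i) u → i ≤ σ.symm u → i < σ.symm u := by
    intro i u hu hi
    refine hi.lt_of_ne ?_
    rintro rfl
    simp at hu
  intro i u hu v hv huv
  rcases lt_trichotomy (σ.symm u) (σ.symm v) with h | h | h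
  · exact key i u v hu.1 hv.1 (hlt hu.1 hu.2) h
  · exact absurd (σ.symm.injective h) huv
  · exact (key i v u hv.1 hu.1 (hlt hv.1 hv.2) h).symm

/-! ### The heuristic finds a biclique partition -/

theorem List.existsUnique_of_countP_eq_one {α : Type*} (P : α → Bool) (l : List α)
    (h : l.countP P = 1) : ∃! i : Fin l.length, P l[i] := by
  induction l with
  | nil => simp at h
  | cons x l ih =>
    rw [List.countP_cons] at h
    by_cases hx : P x
    · simp only [hx, if_true] at h
      have h0 : l.countP P = 0 := by omega
      rw [List.countP_eq_zero] at h0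
      refine ⟨⟨0, by simp⟩, by simpa using hx, ?_⟩
      rintro ⟨i, hi⟩ hP
      cases i with
      | zero => rfl
      | succ i => exact absurd hP (h0 _ (List.getElem_mem (by simpa using hi)))
    · simp only [hx] at h
      obtain ⟨i, hi, huniq⟩ := ih (by simpa using h)
      refine ⟨i.succ, by simpa using hi, ?_⟩
      rintro ⟨j, hj⟩ hP
      cases j with
      | zero => exact absurd hP hx
      | succ j =>
        have := huniq ⟨j, by simpa using hj⟩ hP
        simp [← this]

section Heuristic

variable {n : ℕ} {V : Type*} {H : SimpleGraph V} {S : Finset V} {u v w : V}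

theorem mem_nbrsIn : u ∈ nbrsIn H S v ↔ u ∈ S ∧ H.Adj v u := by
  classical
  simp [nbrsIn]

theorem mem_leftPart : u ∈ leftPart H S v ↔ u ∈ S ∧ u ≠ v ∧ ¬ H.Adj v u := by
  classical
  simp only [leftPart, Finset.mem_sdiff, Finset.mem_union, Finset.mem_singleton, mem_nbrsIn]
  tauto

theorem leftPart_subset : leftPart H S v ⊆ S := fun _ hu => (mem_leftPart.1 hu).1

/-- Membership in `R` needs no distinction between `v` and its neighbours. -/
theorem mem_rightPart (hv : v ∈ S) : u ∈ rightPart H S v ↔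
    u ∈ S ∧ u ∉ leftPart H S v ∧ ∀ w ∈ leftPart H S v, ¬ H.Adj u w := by
  classical
  simp only [rightPart, Finset.mem_union, Finset.mem_singleton, Finset.mem_filter, mem_nbrsIn,
    Finset.eq_empty_iff_forall_notMem, Finset.mem_inter, not_and']
  constructor
  · rintro (rfl | ⟨⟨hu, hvu⟩, h⟩)
    · exact ⟨hv, fun h => (mem_leftPart.1 h).2.1 rfl, fun w hw => (mem_leftPart.1 hw).2.2⟩
    · exact ⟨hu, fun h' => (mem_leftPart.1 h').2.2 hvu,
        fun w hw hwu => h w hw hwu (leftPart_subset hw)⟩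
  · rintro ⟨hu, hL, h⟩
    rw [mem_leftPart] at hL
    by_cases huv : u = v
    · exact .inl huv
    · exact .inr ⟨⟨hu, by tauto⟩, fun w hw hwu _ => h w hw hwu⟩

theorem mem_rightPart_self : v ∈ rightPart H S v := by
  classical
  simp [rightPart]

/-- The edge `uv` belongs to the biclique `B`. -/
def Covers (u v : V) (B : Finset V × Finset V) : Prop :=
  (u ∈ B.1 ∧ v ∈ B.2) ∨ (v ∈ B.1 ∧ u ∈ B.2)

open Classical in
/-- The loop invariant of the heuristic: an edge is covered once, or not at all while both of its
ends remain. -/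
structure IsPartialPartition (G : SimpleGraph V) (A : HeuristicState V) : Prop where
  biclique : ∀ B ∈ A.bp, Disjoint B.1 B.2 ∧ ∀ u ∈ B.1, ∀ v ∈ B.2, G.Adj u v
  count : ∀ u v, G.Adj u v →
    A.bp.countP (fun B => Covers u v B) = if u ∈ A.S ∧ v ∈ A.S then 0 else 1

theorem IsPartialPartition.isBicliquePartition {G : SimpleGraph V} {A : HeuristicState V}
    (h : IsPartialPartition G A) (hS : A.S = ∅) : IsBicliquePartition G A.bp := by
  classical
  refine ⟨h.biclique, fun u v huv => ?_⟩
  have := List.existsUnique_of_countP_eq_one _ _ ((h.count u v huv).trans (by simp [hS]))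
  simp only [decide_eq_true_eq] at this
  exact this

/-- As the remaining neighbours of `v` form a clique of the complement, the edges that lose an end
when `R` is deleted are those between `L` and `R`. -/
theorem HeuristicIteration.isPartialPartition {G : SimpleGraph V} {σ : Fin n ≃ V}
    {A A' : HeuristicState V} (hσ : IsPerfectElimination Gᶜ σ) (hA : IsPartialPartition G A)
    (h : HeuristicIteration Gᶜ σ A A') : IsPartialPartition G A' := by
  classical
  obtain ⟨v, hv, hmin, hS, hbp⟩ := h
  set L := leftPart Gᶜ A.S v with hL
  set R := rightPart Gᶜ A.S v with hR
  have hbi : Disjoint L R ∧ ∀ a ∈ L, ∀ b ∈ R, G.Adj a b := by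
    refine ⟨Finset.disjoint_left.2 fun a ha hb => ((mem_rightPart hv).1 hb).2.1 ha, ?_⟩
    intro a ha b hb
    rw [mem_rightPart hv] at hb
    have hne : b ≠ a := by rintro rfl; exact hb.2.1 ha
    have := hb.2.2 a ha
    rw [SimpleGraph.compl_adj] at this
    exact (not_not.1 fun h' => this ⟨hne, h'⟩).symm
  have hclique : ∀ a ∈ A.S, ∀ b ∈ A.S, G.Adj a b → a ∉ L → b ∉ L → False := by
    intro a ha b hb hab haL hbL
    rw [hL, mem_leftPart, SimpleGraph.compl_adj] at haL hbL
    rcases eq_or_ne a v with rfl | hav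
    · have := hab.ne; tauto
    rcases eq_or_ne b v with rfl | hbv
    · have := hab.symm; tauto
    · have hc := hσ (σ.symm v) (x := a) (y := b) (by simp [hmin a ha]; tauto)
        (by simp [hmin b hb]; tauto) hab.ne
      exact ((SimpleGraph.compl_adj _ _ _).1 hc).2 hab
  have hcov : ∀ a b, G.Adj a b → (Covers a b (L, R) ↔
      (a ∈ A.S ∧ b ∈ A.S) ∧ ¬ (a ∈ A'.S ∧ b ∈ A'.S)) := by
    intro a b hab
    have hR' : ∀ c ∈ R, c ∈ A.S ∧ c ∉ L := fun c hc =>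
      ⟨((mem_rightPart hv).1 hc).1, ((mem_rightPart hv).1 hc).2.1⟩
    simp only [Covers, hS, Finset.mem_sdiff]
    constructor
    · rintro (⟨ha, hb⟩ | ⟨hb, ha⟩)
      · exact ⟨⟨leftPart_subset ha, (hR' b hb).1⟩, fun h => h.2.2 hb⟩
      · exact ⟨⟨(hR' a ha).1, leftPart_subset hb⟩, fun h => h.1.2 ha⟩
    · rintro ⟨⟨ha, hb⟩, h⟩
      by_cases haR : a ∈ R
      · exact .inr ⟨by_contra fun hbL => hclique a ha b hb hab (hR' a haR).2 hbL, haR⟩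
      · have hbR : b ∈ R := by_contra fun hbR => h ⟨⟨ha, haR⟩, hb, hbR⟩
        exact .inl ⟨by_contra fun haL => hclique a ha b hb hab haL (hR' b hbR).2, hbR⟩
  have hsub : A'.S ⊆ A.S := by rw [hS]; exact Finset.sdiff_subset
  by_cases hL0 : L = ∅
  · rw [if_pos hL0] at hbp
    refine ⟨by rw [hbp]; exact hA.biclique, fun a b hab => ?_⟩
    rw [hbp, hA.count a b hab]
    have := hcov a b hab
    have hno : ¬ Covers a b (L, R) := by simp [Covers, hL0]
    have h₁ : a ∈ A'.S → a ∈ A.S := fun h => hsub h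
    have h₂ : b ∈ A'.S → b ∈ A.S := fun h => hsub h
    congr 1
    rw [eq_iff_iff]
    tauto
  · rw [if_neg hL0] at hbp
    refine ⟨?_, fun a b hab => ?_⟩
    · rw [hbp]
      intro B hB
      rcases List.mem_append.1 hB with hB | hB
      · exact hA.biclique B hB
      · rw [List.mem_singleton.1 hB]
        exact hbi
    · rw [hbp, List.countP_append, hA.count a b hab]
      have := hcov a b hab
      have h₁ : a ∈ A'.S → a ∈ A.S := fun h => hsub h
      have h₂ : b ∈ A'.S → b ∈ A.S := fun h => hsub h
      by_cases hin : a ∈ A.S ∧ b ∈ A.S <;> by_cases hin' : a ∈ A'.S ∧ b ∈ A'.S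
      all_goals simp only [List.countP_singleton, decide_eq_true_eq, this, hin, hin']
      all_goals first | rfl | tauto

theorem IsHeuristicRun.isBicliquePartition {G : SimpleGraph (Fin n)} {σ : Fin n ≃ Fin n} {k : ℕ}
    {A : ℕ → HeuristicState (Fin n)} (h : IsHeuristicRun G σ k A) :
    IsBicliquePartition G (A k).bp := by
  obtain ⟨hσ, h0, hstep, hk⟩ := h
  have key : ∀ i ≤ k, IsPartialPartition G (A i) := by
    intro i
    induction i with
    | zero => exact fun _ => by rw [h0]; exact ⟨by simp, by simp⟩
    | succ i ih => exact fun hi => (hstep i (by omega)).2.isPartialPartition hσ (ih (by omega))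
  exact (key k le_rfl).isBicliquePartition hk

end Heuristic

/-! ### Adjacency lists -/

/-- The numbers `j < N` with `P j` are exactly those that occur in the cells `lo, …, hi - 1` of the
array `nb`. -/
structure Enumerates (P : ℕ → Prop) (N lo hi : ℕ) (nb : ℕ → ℕ) : Prop where
  sound : ∀ e, lo ≤ e → e < hi → nb e < N ∧ P (nb e)
  complete : ∀ j < N, P j → ∃ e, lo ≤ e ∧ e < hi ∧ nb e = j

theorem Enumerates.congr {P : ℕ → Prop} {N lo hi : ℕ} {nb nb' : ℕ → ℕ} (h : Enumerates P N lo hi nb)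
    (h' : ∀ e < hi, nb' e = nb e) : Enumerates P N lo hi nb' where
  sound e he he' := by rw [h' e he']; exact h.sound e he he'
  complete j hj hP := by
    obtain ⟨e, he, he', h₁⟩ := h.complete j hj hP
    exact ⟨e, he, he', by rw [h' e he', h₁]⟩

theorem Enumerates.succ_of_not {P : ℕ → Prop} {N lo hi : ℕ} {nb : ℕ → ℕ}
    (h : Enumerates P N lo hi nb)
    (hP : ¬ P N) : Enumerates P (N + 1) lo hi nb where
  sound e he he' := ⟨(h.sound e he he').1.trans (by omega), (h.sound e he he').2⟩
  complete j hj hj' := by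
    refine h.complete j ((Nat.le_of_lt_succ hj).lt_of_ne ?_) hj'
    rintro rfl
    exact hP hj'

theorem Enumerates.succ_of {P : ℕ → Prop} {N lo hi : ℕ} {nb : ℕ → ℕ} (h : Enumerates P N lo hi nb)
    (hlo : lo ≤ hi) (hP : P N) : Enumerates P (N + 1) lo (hi + 1) (Function.update nb hi N) where
  sound e he he' := by
    rcases Nat.lt_succ_iff_lt_or_eq.1 he' with h' | rfl
    · rw [Function.update_of_ne h'.ne]
      exact ⟨(h.sound e he h').1.trans (by omega), (h.sound e he h').2⟩
    · simpa using hP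
  complete j hj hj' := by
    rcases Nat.lt_succ_iff_lt_or_eq.1 hj with h' | rfl
    · obtain ⟨e, he, he', h₁⟩ := h.complete j h' hj'
      exact ⟨e, he, by omega, by rw [Function.update_of_ne he'.ne, h₁]⟩
    · exact ⟨hi, hlo, by omega, by simp⟩

namespace CochordalProgram

open RamProg RamExp

/-! The programs use the following memory cells.

Registers: `0` the number `n` of vertices, `1` the number of bicliques, `2` the position of the
next biclique in array `1`, `3` the current vertex `v`, `4` and `5` loop counters, `6` a
position in a matrix, `7` the end of the adjacency lists, `8` the largest weight plus one, `9`
and `10` a position in an adjacency list and its end, `11` whether `L` is nonempty, `12` an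
entry of a row of array `1`.

Arrays: `0` the adjacency matrix of `G`, `1` the bicliques, `2` the set `S` (while the ordering
is built: the numbered vertices), `3` the ordering, `4` and `5` the adjacency lists of the
complement, `6` the beginnings of the rows of the adjacency matrix, `7` the weights, `8` the set
`L`. -/

attribute [local simp] RamExp.eval RamExp.cost RamTest.Holds RamTest.cost

/-- Scans a row of the adjacency matrix and appends the neighbours in the complement to the
lists. -/
def scanRow : RamProg :=
  .loop (.lt (reg 5) (reg 0))
    (.cond (.eq (reg 4) (reg 5)) .skip
      (.cond (.eq (get 0 (reg 6)) (const 0))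
        (.put 5 (reg 7) (reg 5) ;; .set 7 (succ (reg 7))) .skip) ;;
    .set 6 (succ (reg 6)) ;;
    .set 5 (succ (reg 5)))

/-- Scanning row `i`, which begins at `p`, appends the list of `i` at `q`; `P` is the adjacency of
`i` in the complement.  The diagonal entry of the matrix is zero although `i` is not its
own neighbour, so it is left out. -/
theorem scanRow_spec {n i p q : ℕ} {P : ℕ → Prop} [DecidablePred P] {s : RamStore}
    (h0 : s.reg 0 = n) (h4 : s.reg 4 = i) (h5 : s.reg 5 = 0) (h6 : s.reg 6 = p) (h7 : s.reg 7 = q)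
    (hi : ¬ P i) (hP : ∀ j < n, j ≠ i → (s.arr 0 (p + j) = 0 ↔ P j)) :
    Halts scanRow s fun s' t => t ≤ 30 * n + 3 ∧ s'.reg 6 = p + n ∧
      s'.reg 7 = q + Nat.count P n ∧ (∀ e < q, s'.arr 5 e = s.arr 5 e) ∧
      Enumerates P n q (q + Nat.count P n) (s'.arr 5) := by
  refine (Halts.loop_up (fun j s' => s'.reg 6 = p + j ∧ s'.reg 7 = q + Nat.count P j ∧
    (∀ e < q, s'.arr 5 e = s.arr 5 e) ∧ Enumerates P j q (q + Nat.count P j) (s'.arr 5))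
    (fun j => 30 * j) (Nat.zero_le n) h5 h0 (by decide) ?_ ?_).mono ?_
  · exact ⟨h6, h7, fun _ _ => rfl, fun e he he' => by simp at he'; omega, by simp⟩
  · rintro j - hj s' hs' hj5 ⟨h6', h7', hold, hL⟩
    have h4' : s'.reg 4 = i := (hs'.reg 4 (by decide)).trans h4
    have harr : s'.arr 0 = s.arr 0 := hs'.arr 0 (by decide)
    have hP' := hP j hj
    refine .seq (.cond (fun hb => ?_) fun hb => .cond (fun hb' => ?_) fun hb' => ?_)
    · have hij : j = i := by simpa [h4', hj5, eq_comm] using hb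
      subst hij
      refine .skip (.seq (.set (.set ?_)))
      simp only [Nat.count_succ, hi, if_false]
      simp [h6', h7', hj5, add_assoc]
      exact ⟨by omega, hold, hL.succ_of_not hi⟩
    · have hij : j ≠ i := by simpa [h4', hj5, eq_comm] using hb
      have hPj : P j := (hP j hj hij).1 (by simpa [h6', harr] using hb')
      refine .seq (.put (.set (.seq (.set (.set ?_)))))
      simp only [Nat.count_succ, hPj, if_true]
      simp [h6', h7', hj5, add_assoc]
      refine ⟨by omega, fun e he => ?_, hL.succ_of (by omega) hPj⟩
      rw [Function.update_of_ne (by omega), hold e he]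
    · have hij : j ≠ i := by simpa [h4', hj5, eq_comm] using hb
      have hPj : ¬ P j := fun h => hb' (by simpa [h6', harr] using (hP j hj hij).2 h)
      refine .skip (.seq (.set (.set ?_)))
      simp only [Nat.count_succ, hPj, if_false]
      simp [h6', h7', hj5, add_assoc]
      exact ⟨by omega, hold, hL.succ_of_not hPj⟩
  · rintro s' t - ⟨ht, h⟩
    exact ⟨by omega, h.2⟩

/-- Builds the adjacency lists of the complement: those of `i` occupy the cells of array `5`
from `arr 4 i` up to `arr 4 (i + 1)`.  Array `6` receives the beginnings of the rows of the
adjacency matrix. -/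
def buildLists : RamProg :=
  .set 4 (const 0) ;;
  .loop (.lt (reg 4) (reg 0))
    (.put 6 (reg 4) (reg 6) ;;
    .set 5 (const 0) ;;
    scanRow ;;
    .set 4 (succ (reg 4)) ;;
    .put 4 (reg 4) (reg 7))

/-- The arrays `st` and `nb` hold adjacency lists of the relation `a` on the numbers below `n`. -/
structure IsAdjList (a : ℕ → ℕ → Prop) (n : ℕ) (st nb : ℕ → ℕ) : Prop where
  mono : ∀ i < n, st i ≤ st (i + 1)
  lists : ∀ i < n, Enumerates (a i) n (st i) (st (i + 1)) nb

theorem IsAdjList.le_last {a : ℕ → ℕ → Prop} {n : ℕ} {st nb : ℕ → ℕ} (h : IsAdjList a n st nb)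
    {i : ℕ} (hi : i ≤ n) : st i ≤ st n := by
  obtain ⟨d, rfl⟩ := Nat.exists_eq_add_of_le hi
  have : ∀ d', d' ≤ d → st i ≤ st (i + d') := by
    intro d'
    induction d' with
    | zero => simp
    | succ d' ih => exact fun hd => (ih (by omega)).trans (h.mono _ (by omega))
  exact this d le_rfl

theorem buildLists_spec {n : ℕ} {a : ℕ → ℕ → Prop} [∀ i, DecidablePred (a i)] {s : RamStore}
    (h0 : s.reg 0 = n) (h6 : s.reg 6 = 0) (h7 : s.reg 7 = 0) (hst : s.arr 4 0 = 0)
    (hirr : ∀ i, ¬ a i i)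
    (ha : ∀ i < n, ∀ j < n, j ≠ i → (s.arr 0 (i * n + j) = 0 ↔ a i j)) :
    Halts buildLists s fun s' t => t ≤ (30 * n + 30) * n + 10 ∧ (∀ i < n, s'.arr 6 i = i * n) ∧
      s'.arr 4 n = ∑ i ∈ Finset.range n, Nat.count (a i) n ∧
      IsAdjList a n (s'.arr 4) (s'.arr 5) := by
  -- `D i` is the position at which the list of `i` begins
  let D : ℕ → ℕ := fun i => ∑ i' ∈ Finset.range i, Nat.count (a i') n
  have hD : ∀ i, D (i + 1) = D i + Nat.count (a i) n := fun i => Finset.sum_range_succ _ _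
  have hDmono : Monotone D := monotone_nat_of_le_succ fun i => by rw [hD]; omega
  refine .seq (.set ?_)
  refine (Halts.loop_up (fun i s' => s'.reg 6 = i * n ∧ s'.reg 7 = D i ∧
    (∀ i' < i, s'.arr 6 i' = i' * n) ∧ (∀ i' ≤ i, s'.arr 4 i' = D i') ∧
    (∀ i' < i, Enumerates (a i') n (D i') (D (i' + 1)) (s'.arr 5)))
    (fun i => (30 * n + 30) * i) (Nat.zero_le n) (by simp) (by simpa) (by decide) ?_ ?_).mono ?_
  · simp [h6, h7, hst, D]
  · rintro i - hi s' hs' hi4 ⟨h6', h7', hrow, hst', hL⟩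
    have h0' : s'.reg 0 = n := (hs'.reg 0 (by decide)).trans (by simpa)
    have harr : s'.arr 0 = s.arr 0 := hs'.arr 0 (by decide)
    refine .seq (.put (.seq (.set (.seq ((scanRow_spec (n := n) (i := i) (p := i * n) (q := D i)
      (P := a i) (by simpa) (by simpa) (by simp) (by simpa) (by simpa) (hirr i) ?_).mono ?_)))))
    · simpa [harr] using ha i hi
    rintro s₁ t₁ hs₁ ⟨ht₁, h6₁, h7₁, hold₁, hL₁⟩
    have h4₁ : s₁.reg 4 = i := (hs₁.reg 4 (by decide)).trans (by simpa)
    have harr6 : s₁.arr 6 = Function.update (s'.arr 6) i (i * n) :=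
      (hs₁.arr 6 (by decide)).trans (by simp [hi4, h6'])
    have harr4 : s₁.arr 4 = s'.arr 4 := (hs₁.arr 4 (by decide)).trans (by simp)
    have harr5 : ∀ e < D i, s₁.arr 5 e = s'.arr 5 e := by simpa using hold₁
    refine .seq (.set (.put ?_))
    rw [← hD] at h7₁ hL₁
    simp [h4₁, harr4, harr6, h6₁, h7₁]
    refine ⟨by linarith, by ring, ?_, ?_, ?_⟩
    · intro i' hi'
      rcases hi'.lt_or_eq with h | rfl
      · rw [Function.update_of_ne h.ne, hrow i' h]
      · simp
    · intro i' hi'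
      rcases hi'.lt_or_eq with h | rfl
      · rw [Function.update_of_ne h.ne, hst' i' (by omega)]
      · simp
    · intro i' hi'
      rcases hi'.lt_or_eq with h | rfl
      · exact (hL i' h).congr fun e he => harr5 e (he.trans_le (hDmono h))
      · exact hL₁
  · rintro s' t - ⟨ht, -, -, -, hrow, hst', hL⟩
    refine ⟨by simp at ht ⊢; omega, hrow, hst' n le_rfl, fun i hi => ?_, fun i hi => ?_⟩
    · rw [hst' i hi.le, hst' _ hi]
      exact hDmono (by omega)
    · rw [hst' i hi.le, hst' _ hi]
      exact hL i hi

/-! ### The search program -/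

/-- Finds a vertex `v` of largest weight among those with `arr 2 v = 0`. -/
def findMax : RamProg :=
  .set 8 (const 0) ;;
  .set 5 (const 0) ;;
  .loop (.lt (reg 5) (reg 0))
    (.cond (.eq (get 2 (reg 5)) (const 0))
      (.cond (.lt (reg 8) (succ (get 7 (reg 5))))
        (.set 8 (succ (get 7 (reg 5))) ;; .set 3 (reg 5)) .skip) .skip ;;
    .set 5 (succ (reg 5)))

theorem findMax_spec {n : ℕ} {s : RamStore} (h0 : s.reg 0 = n) (hex : ∃ u < n, s.arr 2 u = 0) :
    Halts findMax s fun s' t => t ≤ 30 * n + 10 ∧ s'.reg 3 < n ∧ s.arr 2 (s'.reg 3) = 0 ∧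
      ∀ u < n, s.arr 2 u = 0 → s.arr 7 u ≤ s.arr 7 (s'.reg 3) := by
  refine .seq (.set (.seq (.set ?_)))
  -- register `8` is `0` as long as no candidate has been seen, and its weight plus one afterwards
  refine (Halts.loop_up (fun j s' => (s'.reg 8 = 0 ∧ ∀ u < j, s.arr 2 u ≠ 0) ∨
    (s'.reg 8 = s.arr 7 (s'.reg 3) + 1 ∧ s'.reg 3 < n ∧ s.arr 2 (s'.reg 3) = 0 ∧
      ∀ u < j, s.arr 2 u = 0 → s.arr 7 u ≤ s.arr 7 (s'.reg 3)))
    (fun j => 30 * j) (Nat.zero_le n) (by simp) (by simpa) (by decide) ?_ ?_).mono ?_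
  · simp
  · intro j _ hj s' hs' hj5 hI
    have harr2 : s'.arr 2 = s.arr 2 := hs'.arr 2 (by decide)
    have harr7 : s'.arr 7 = s.arr 7 := hs'.arr 7 (by decide)
    refine .seq (.cond (fun hb => .cond (fun hb' => ?_) fun hb' => ?_) fun hb => ?_)
    · simp [harr2, hj5] at hb
      simp [harr7, hj5] at hb'
      refine .seq (.set (.set (.set ?_)))
      simp [hj5, harr7]
      refine ⟨by omega, hj, hb, fun u hu hu0 => ?_⟩
      rcases hu.lt_or_eq with h | rfl
      · rcases hI with ⟨-, hI⟩ | ⟨h8, -, -, hI⟩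
        · exact absurd hu0 (hI u h)
        · have := hI u h hu0
          omega
      · exact le_rfl
    · simp [harr2, hj5] at hb
      simp [harr7, hj5] at hb'
      refine .skip (.set ?_)
      simp [hj5]
      refine ⟨by omega, .inr ?_⟩
      rcases hI with ⟨h8, -⟩ | ⟨h8, h3, h3', hI⟩
      · omega
      · refine ⟨h8, h3, h3', fun u hu hu0 => ?_⟩
        rcases hu.lt_or_eq with h | rfl
        · exact hI u h hu0
        · omega
    · simp [harr2, hj5] at hb
      refine .skip (.set ?_)
      simp [hj5]
      refine ⟨by omega, ?_⟩
      rcases hI with ⟨h8, hI⟩ | ⟨h8, h3, h3', hI⟩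
      · refine .inl ⟨h8, fun u hu => ?_⟩
        rcases hu.lt_or_eq with h | rfl
        · exact hI u h
        · exact hb
      · refine .inr ⟨h8, h3, h3', fun u hu hu0 => ?_⟩
        rcases hu.lt_or_eq with h | rfl
        · exact hI u h hu0
        · exact absurd hu0 hb
  · rintro s' t - ⟨ht, -, hI⟩
    refine ⟨by simp at ht ⊢; omega, ?_⟩
    rcases hI with ⟨-, hI⟩ | ⟨-, hI⟩
    · obtain ⟨u, hu, hu0⟩ := hex
      exact absurd hu0 (hI u hu)
    · exact hI

/-- Increases the weights of the vertices that are not adjacent in `G` to the vertex in register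
`3`. -/
def updateWeights : RamProg :=
  .set 6 (get 6 (reg 3)) ;;
  .set 5 (const 0) ;;
  .loop (.lt (reg 5) (reg 0))
    (.cond (.eq (get 0 (reg 6)) (const 0)) (.put 7 (reg 5) (succ (get 7 (reg 5)))) .skip ;;
    .set 6 (succ (reg 6)) ;;
    .set 5 (succ (reg 5)))

theorem updateWeights_spec {n p : ℕ} {s : RamStore} (h0 : s.reg 0 = n)
    (hp : s.arr 6 (s.reg 3) = p) :
    Halts updateWeights s fun s' t => t ≤ 30 * n + 10 ∧
      ∀ u < n, s'.arr 7 u = s.arr 7 u + if s.arr 0 (p + u) = 0 then 1 else 0 := by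
  refine .seq (.set (.seq (.set ?_)))
  refine (Halts.loop_up (fun j s' => s'.reg 6 = p + j ∧
    (∀ u < j, s'.arr 7 u = s.arr 7 u + if s.arr 0 (p + u) = 0 then 1 else 0) ∧
    ∀ u, j ≤ u → s'.arr 7 u = s.arr 7 u)
    (fun j => 30 * j) (Nat.zero_le n) (by simp) (by simpa) (by decide) ?_ ?_).mono ?_
  · simp [hp]
  · rintro j - hj s' hs' hj5 ⟨h6, hlt, hge⟩
    have harr0 : s'.arr 0 = s.arr 0 := hs'.arr 0 (by decide)
    refine .seq (.cond (fun hb => ?_) fun hb => ?_)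
    · simp [harr0, h6] at hb
      refine .put (.seq (.set (.set ?_)))
      simp [hj5, h6, add_assoc]
      refine ⟨by omega, fun u hu => ?_, fun u hu => ?_⟩
      · rcases hu.lt_or_eq with h | rfl
        · rw [Function.update_of_ne h.ne, hlt u h]
        · simp [hb, hge]
      · rw [Function.update_of_ne (by omega), hge u (by omega)]
    · simp [harr0, h6] at hb
      refine .skip (.seq (.set (.set ?_)))
      simp [hj5, h6, add_assoc]
      refine ⟨by omega, fun u hu => ?_, fun u hu => hge u (by omega)⟩
      rcases hu.lt_or_eq with h | rfl
      · exact hlt u h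
      · simp [hb, hge]
  · rintro s' t - ⟨ht, -, -, hI, -⟩
    exact ⟨by simp at ht ⊢; omega, hI⟩

/-- Fills the ordering (array `3`) from its last position downwards, each time with an unnumbered
vertex that has the most numbered neighbours in the complement.  Array `2` marks the numbered
vertices; at the end it marks all of them, as the heuristic requires. -/
def search : RamProg :=
  .set 4 (reg 0) ;;
  .loop (.lt (const 0) (reg 4))
    (.set 4 (sub (reg 4) (const 1)) ;;
    findMax ;;
    .put 3 (reg 4) (reg 3) ;;
    .put 2 (reg 3) (const 1) ;;
    updateWeights)

section Search

variable (a : ℕ → ℕ → Prop) [∀ i, DecidablePred (a i)] (n : ℕ)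

/-- The number of neighbours of `u` among `f k, …, f (n - 1)`. -/
def weight (k : ℕ) (f : ℕ → ℕ) (u : ℕ) : ℕ :=
  ((Finset.Ico k n).filter fun q => a (f q) u).card

/-- The values `f k, …, f (n - 1)` are the last ones of an ordering of the numbers below `n` by
maximum cardinality search. -/
structure IsSearchSuffix (k : ℕ) (f : ℕ → ℕ) : Prop where
  lt : ∀ p, k ≤ p → p < n → f p < n
  ne : ∀ p q, k ≤ p → p < q → q < n → f p ≠ f q
  max : ∀ p, k ≤ p → p < n → ∀ u < n, (∀ q, p ≤ q → q < n → f q ≠ u) →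
    weight a n (p + 1) f u ≤ weight a n (p + 1) f (f p)

variable {a n}

theorem weight_congr {k : ℕ} {f f' : ℕ → ℕ} (h : ∀ q, k ≤ q → q < n → f q = f' q) (u : ℕ) :
    weight a n k f u = weight a n k f' u := by
  unfold weight
  congr 1
  refine Finset.filter_congr fun q hq => ?_
  rw [Finset.mem_Ico] at hq
  rw [h q hq.1 hq.2]

theorem weight_eq_add {k : ℕ} (hk : k < n) (f : ℕ → ℕ) (u : ℕ) :
    weight a n k f u = weight a n (k + 1) f u + if a (f k) u then 1 else 0 := by
  unfold weight
  rw [← Finset.insert_Ico_add_one_left_eq_Ico hk, Finset.filter_insert]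
  split_ifs with h
  · rw [Finset.card_insert_of_notMem (by simp)]
  · rfl

/-- While some position is still free, some vertex is still unnumbered. -/
theorem exists_not_mem_suffix {k : ℕ} (hk : 0 < k) (hkn : k ≤ n) (f : ℕ → ℕ) :
    ∃ u < n, ∀ q, k ≤ q → q < n → f q ≠ u := by
  by_contra! h
  have hsub : Finset.range n ⊆ (Finset.Ico k n).image f := by
    intro u hu
    obtain ⟨q, hq, hq', hqu⟩ := h u (Finset.mem_range.1 hu)
    exact Finset.mem_image.2 ⟨q, Finset.mem_Ico.2 ⟨hq, hq'⟩, hqu⟩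
  have := (Finset.card_le_card hsub).trans Finset.card_image_le
  simp at this
  omega

/-- Placing an unnumbered vertex of largest weight at position `k` continues the search. -/
theorem IsSearchSuffix.update {k v : ℕ} {f : ℕ → ℕ} (h : IsSearchSuffix a n (k + 1) f)
    (hv : v < n) (hne : ∀ q, k < q → q < n → f q ≠ v)
    (hmax : ∀ u < n, (∀ q, k < q → q < n → f q ≠ u) →
      weight a n (k + 1) f u ≤ weight a n (k + 1) f v) :
    IsSearchSuffix a n k (Function.update f k v) := by
  have hf : ∀ q, k < q → Function.update f k v q = f q := fun q hq =>
    Function.update_of_ne hq.ne' _ _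
  refine ⟨?_, ?_, ?_⟩
  · intro p hp hpn
    rcases hp.lt_or_eq with hp | rfl
    · rw [hf p hp]
      exact h.lt p hp hpn
    · simpa
  · intro p q hp hpq hqn
    rw [hf q (by omega)]
    rcases hp.lt_or_eq with hp | rfl
    · rw [hf p hp]
      exact h.ne p q hp hpq hqn
    · simpa using (hne q hpq hqn).symm
  · intro p hp hpn u hu hpu
    rw [weight_congr (fun q hq _ => hf q (by omega)), weight_congr (fun q hq _ => hf q (by omega))]
    rcases hp.lt_or_eq with hp | rfl
    · rw [hf p hp]
      exact h.max p hp hpn u hu fun q hq hqn => by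
        rw [← hf q (by omega)]
        exact hpu q hq hqn
    · rw [Function.update_self]
      exact hmax u hu fun q hq hqn => by
        rw [← hf q hq]
        exact hpu q hq.le hqn

theorem search_spec {s : RamStore} (h0 : s.reg 0 = n) (h2 : ∀ u < n, s.arr 2 u = 0)
    (h6 : ∀ i < n, s.arr 6 i = i * n) (h7 : ∀ u < n, s.arr 7 u = 0)
    (ha : ∀ i < n, ∀ j < n, j ≠ i → (s.arr 0 (i * n + j) = 0 ↔ a i j)) :
    Halts search s fun s' t => t ≤ (60 * n + 60) * n + 10 ∧ IsSearchSuffix a n 0 (s'.arr 3) ∧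
      ∀ u < n, (∃ q < n, s'.arr 3 q = u) → s'.arr 2 u = 1 := by
  refine .seq (.set ?_)
  refine (Halts.loop (N := n) (fun k s' => s'.reg 4 = k ∧ IsSearchSuffix a n k (s'.arr 3) ∧
    (∀ u < n, s'.arr 2 u = 0 ∧ (∀ q, k ≤ q → q < n → s'.arr 3 q ≠ u) ∨
      s'.arr 2 u = 1 ∧ ∃ q, k ≤ q ∧ q < n ∧ s'.arr 3 q = u) ∧
    ∀ u < n, s'.arr 2 u = 0 → s'.arr 7 u = weight a n k (s'.arr 3) u)
    (fun k => (60 * n + 60) * k) ?_ ?_ ?_).mono ?_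
  · refine ⟨by simpa, ⟨by omega, by omega, by omega⟩,
      fun u hu => .inl ⟨by simp [h2 u hu], by omega⟩, fun u hu _ => by simp [h7 u hu, weight]⟩
  · rintro k hk s' hs' ⟨h4, hf, hmark, hwt⟩
    have h0' : s'.reg 0 = n := (hs'.reg 0 (by decide)).trans (by simpa)
    have harr0 : s'.arr 0 = s.arr 0 := hs'.arr 0 (by decide)
    have harr6 : s'.arr 6 = s.arr 6 := hs'.arr 6 (by decide)
    refine ⟨by simp [h4], .seq (.set (.seq ((findMax_spec (n := n) (by simpa) ?_).mono ?_)))⟩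
    · obtain ⟨u, hu, hu'⟩ := exists_not_mem_suffix (Nat.succ_pos k) hk (s'.arr 3)
      refine ⟨u, hu, ?_⟩
      rcases hmark u hu with h | ⟨-, q, hq, hq', hqu⟩
      · exact h.1
      · exact absurd hqu (hu' q hq hq')
    rintro s₁ t₁ hs₁ ⟨ht₁, hv, hv0, hmax⟩
    simp at hv0 hmax
    have h0₁ : s₁.reg 0 = n := (hs₁.reg 0 (by decide)).trans (by simpa)
    have h4₁ : s₁.reg 4 = k := (hs₁.reg 4 (by decide)).trans (by simp [h4])
    have harr₁ : s₁.arr = s'.arr := by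
      funext b
      exact hs₁.arr b (by simp [findMax, RamProg.arrs])
    set v := s₁.reg 3
    refine .seq (.put (.seq (.put
      ((updateWeights_spec (n := n) (p := v * n) (by simpa) ?_).mono ?_))))
    · simp [harr₁, harr6]
      exact h6 v hv
    rintro s₂ t₂ hs₂ ⟨ht₂, h7₂⟩
    simp [harr₁, harr0] at h7₂
    have h4₂ : s₂.reg 4 = k := (hs₂.reg 4 (by decide)).trans (by simpa)
    have harr3 : s₂.arr 3 = Function.update (s'.arr 3) k v :=
      (hs₂.arr 3 (by decide)).trans (by simp [h4₁, harr₁, v])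
    have harr2 : s₂.arr 2 = Function.update (s'.arr 2) v 1 :=
      (hs₂.arr 2 (by decide)).trans (by simp [harr₁, v])
    have hzero : ∀ u < n, (s'.arr 2 u = 0 ↔ ∀ q, k < q → q < n → s'.arr 3 q ≠ u) := by
      intro u hu
      rcases hmark u hu with h | ⟨h, q, hq, hq', hqu⟩
      · exact ⟨fun _ => h.2, fun _ => h.1⟩
      · exact ⟨fun h' => by omega, fun h' => absurd hqu (h' q hq hq')⟩
    refine ⟨?_, h4₂, ?_, ?_, ?_⟩
    · simp
      linarith
    · rw [harr3]
      refine hf.update hv ((hzero v hv).1 hv0) fun u hu hu' => ?_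
      have hu0 := (hzero u hu).2 hu'
      rw [← hwt u hu hu0, ← hwt v hv hv0]
      exact hmax u hu hu0
    · intro u hu
      rw [harr2, harr3]
      by_cases huv : u = v
      · exact .inr ⟨by simp [huv], k, le_rfl, hk, by simp [huv]⟩
      · rw [Function.update_of_ne huv]
        refine (hmark u hu).imp (fun h => ⟨h.1, fun q hq hqn => ?_⟩) fun ⟨h, q, hq, hqn, hqu⟩ =>
          ⟨h, q, by omega, hqn, by rw [Function.update_of_ne (by omega), hqu]⟩
        rcases hq.lt_or_eq with hq | rfl
        · rw [Function.update_of_ne hq.ne']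
          exact h.2 q hq hqn
        · simpa using Ne.symm huv
    · intro u hu hu0
      rw [harr2] at hu0
      by_cases huv : u = v
      · simp [huv] at hu0
      · rw [Function.update_of_ne huv] at hu0
        rw [h7₂ u hu, harr3, weight_eq_add hk, Function.update_self, hwt u hu hu0,
          weight_congr fun q hq _ => Function.update_of_ne (show q ≠ k by omega) v (s'.arr 3)]
        simp only [ha v hv u hu huv]
  · rintro s' - ⟨h4, -⟩
    simp [h4]
  · rintro s' t - ⟨ht, -, hf, hmark, -⟩
    refine ⟨by simp at ht ⊢; omega, hf, fun u hu ⟨q, hq, hqu⟩ => ?_⟩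
    rcases hmark u hu with h | h
    · exact absurd hqu (h.2 q (Nat.zero_le q) hq)
    · exact h.1

end Search

/-! ### The iteration program -/

/-- Puts into register `3` the first vertex of `S` in the ordering, or `n` if `S` is empty. -/
def findFirst : RamProg :=
  .set 3 (reg 0) ;;
  .set 4 (reg 0) ;;
  .loop (.lt (const 0) (reg 4))
    (.set 4 (sub (reg 4) (const 1)) ;;
    .cond (.eq (get 2 (get 3 (reg 4))) (const 1)) (.set 3 (get 3 (reg 4))) .skip)

theorem findFirst_spec {n : ℕ} {s : RamStore} (h0 : s.reg 0 = n) :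
    Halts findFirst s fun s' t => t ≤ 30 * n + 10 ∧
      ((s'.reg 3 = n ∧ ∀ i < n, s.arr 2 (s.arr 3 i) ≠ 1) ∨
        ∃ i < n, s'.reg 3 = s.arr 3 i ∧ s.arr 2 (s.arr 3 i) = 1 ∧
          ∀ j < i, s.arr 2 (s.arr 3 j) ≠ 1) := by
  refine .seq (.set (.seq (.set ?_)))
  refine (Halts.loop (N := n) (fun k s' => s'.reg 4 = k ∧
    ((s'.reg 3 = n ∧ ∀ i, k ≤ i → i < n → s.arr 2 (s.arr 3 i) ≠ 1) ∨
      ∃ i < n, s'.reg 3 = s.arr 3 i ∧ s.arr 2 (s.arr 3 i) = 1 ∧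
        ∀ j, k ≤ j → j < i → s.arr 2 (s.arr 3 j) ≠ 1))
    (fun k => 30 * k) ?_ ?_ ?_).mono ?_
  · exact ⟨by simpa, .inl ⟨by simpa, by omega⟩⟩
  · rintro k hk s' hs' ⟨h4, hI⟩
    have harr2 : s'.arr 2 = s.arr 2 := hs'.arr 2 (by decide)
    have harr3 : s'.arr 3 = s.arr 3 := hs'.arr 3 (by decide)
    refine ⟨by simp [h4], .seq (.set (.cond (fun hb => .set ?_) fun hb => .skip ?_))⟩
    · simp [h4, harr2, harr3] at hb
      simp [h4, harr3]
      exact ⟨by omega, .inr ⟨k, hk, rfl, hb, by omega⟩⟩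
    · simp [h4, harr2, harr3] at hb
      simp [h4]
      refine ⟨by omega, hI.imp (fun h => ⟨h.1, fun i hi hi' => ?_⟩) fun ⟨i, hi, h, h', h''⟩ =>
        ⟨i, hi, h, h', fun j hj hj' => ?_⟩⟩
      · rcases hi.lt_or_eq with hi | rfl
        exacts [h.2 i hi hi', hb]
      · rcases hj.lt_or_eq with hj | rfl
        exacts [h'' j hj hj', hb]
  · rintro s' - ⟨h4, -⟩
    simp [h4]
  · rintro s' t - ⟨ht, -, hI⟩
    exact ⟨by simp at ht ⊢; omega, by simpa using hI⟩

/-- Marks the elements of `L` in array `8`. -/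
def markLeft : RamProg :=
  .set 5 (const 0) ;;
  .loop (.lt (reg 5) (reg 0)) (.put 8 (reg 5) (get 2 (reg 5)) ;; .set 5 (succ (reg 5))) ;;
  .put 8 (reg 3) (const 0) ;;
  .set 9 (get 4 (reg 3)) ;;
  .set 10 (get 4 (succ (reg 3))) ;;
  .loop (.lt (reg 9) (reg 10)) (.put 8 (get 5 (reg 9)) (const 0) ;; .set 9 (succ (reg 9)))

open Classical in
theorem markLeft_spec {n v : ℕ} {a : ℕ → ℕ → Prop} {s : RamStore} (h0 : s.reg 0 = n)
    (h3 : s.reg 3 = v) (hv : v < n) (hadj : IsAdjList a n (s.arr 4) (s.arr 5)) :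
    Halts markLeft s fun s' t => t ≤ 30 * n + 30 * s.arr 4 n + 40 ∧
      ∀ u < n, s'.arr 8 u = if u = v ∨ a v u then 0 else s.arr 2 u := by
  refine .seq (.set (.seq ?_))
  refine (Halts.loop_up (fun j s' => ∀ u < j, s'.arr 8 u = s.arr 2 u)
    (fun j => 30 * j) (Nat.zero_le n) (by simp) (by simpa) (by decide) ?_ ?_).mono ?_
  · simp
  · intro j _ hj s' hs' hj5 hI
    have harr2 : s'.arr 2 = s.arr 2 := hs'.arr 2 (by decide)
    refine .seq (.put (.set ?_))
    simp [hj5, harr2]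
    refine ⟨by omega, fun u hu => ?_⟩
    rcases hu.lt_or_eq with h | rfl
    · rw [Function.update_of_ne h.ne, hI u h]
    · simp
  rintro s₁ t₁ hs₁ ⟨ht₁, -, h8⟩
  have h3₁ : s₁.reg 3 = v := (hs₁.reg 3 (by decide)).trans (by simpa)
  have harr4 : s₁.arr 4 = s.arr 4 := hs₁.arr 4 (by decide)
  have harr5 : s₁.arr 5 = s.arr 5 := hs₁.arr 5 (by decide)
  refine .seq (.put (.seq (.set (.seq (.set ?_)))))
  refine (Halts.loop_up (fun e s' => ∀ u < n, s'.arr 8 u =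
    if u = v ∨ ∃ e', s.arr 4 v ≤ e' ∧ e' < e ∧ s.arr 5 e' = u then 0 else s.arr 2 u)
    (fun e => 30 * e) (hadj.mono v hv) (by simp [h3₁, harr4]) (by simp [h3₁, harr4]) (by decide)
    ?_ ?_).mono ?_
  · intro u hu
    have hno : ¬ ∃ e', s.arr 4 v ≤ e' ∧ e' < s.arr 4 v ∧ s.arr 5 e' = u := by
      rintro ⟨e', h, h', -⟩
      omega
    simp only [hno, or_false]
    by_cases huv : u = v
    · simp [huv, h3₁]
    · simp [huv, h3₁, h8 u hu]
  · intro e he he' s' hs' he9 hI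
    have harr5' : s'.arr 5 = s.arr 5 := (hs'.arr 5 (by decide)).trans (by simpa)
    refine .seq (.put (.set ?_))
    simp [he9, harr5']
    refine ⟨by omega, fun u hu => ?_⟩
    by_cases hue : u = s.arr 5 e
    · rw [hue, Function.update_self, if_pos (.inr ⟨e, he, le_rfl, rfl⟩)]
    · rw [Function.update_of_ne hue, hI u hu]
      congr 2
      rw [eq_iff_iff]
      constructor
      · rintro ⟨e', h, h', h''⟩
        exact ⟨e', h, h'.le, h''⟩
      · rintro ⟨e', h, h', rfl⟩
        exact ⟨e', h, h'.lt_of_ne fun h => hue (h ▸ rfl), rfl⟩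
  · rintro s' t - ⟨ht, -, hI⟩
    have := hadj.le_last (i := v + 1) hv
    refine ⟨by simp at ht ht₁ ⊢; omega, fun u hu => ?_⟩
    rw [hI u hu]
    congr 2
    rw [eq_iff_iff]
    constructor
    · rintro ⟨e, h, h', rfl⟩
      exact ((hadj.lists v hv).sound e h h').2
    · exact fun h => (hadj.lists v hv).complete u hu h

/-- Puts `0` or `2` into register `12` according to whether the vertex in register `5` has a
neighbour in `L` or not. -/
def scanNbrs : RamProg :=
  .set 12 (const 2) ;;
  .set 9 (get 4 (reg 5)) ;;
  .set 10 (get 4 (succ (reg 5))) ;;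
  .loop (.lt (reg 9) (reg 10))
    (.cond (.eq (get 8 (get 5 (reg 9))) (const 1)) (.set 12 (const 0)) .skip ;;
    .set 9 (succ (reg 9)))

open Classical in
theorem scanNbrs_spec {n u : ℕ} {a : ℕ → ℕ → Prop} {s : RamStore} (h5 : s.reg 5 = u) (hu : u < n)
    (hadj : IsAdjList a n (s.arr 4) (s.arr 5)) :
    Halts scanNbrs s fun s' t => t + 30 * s.arr 4 u ≤ 30 * s.arr 4 (u + 1) + 20 ∧
      s'.reg 12 = if ∃ w < n, a u w ∧ s.arr 8 w = 1 then 0 else 2 := by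
  refine .seq (.set (.seq (.set (.seq (.set ?_)))))
  refine (Halts.loop_up (fun e s' => s'.reg 12 =
    if ∃ e', s.arr 4 u ≤ e' ∧ e' < e ∧ s.arr 8 (s.arr 5 e') = 1 then 0 else 2)
    (fun e => 30 * e) (hadj.mono u hu) (by simp [h5]) (by simp [h5]) (by decide) ?_ ?_).mono ?_
  · rw [if_neg]
    · simp
    · rintro ⟨e', h, h', -⟩
      omega
  · intro e he he' s' hs' he9 hI
    have harr5 : s'.arr 5 = s.arr 5 := hs'.arr 5 (by decide)
    have harr8 : s'.arr 8 = s.arr 8 := hs'.arr 8 (by decide)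
    refine .seq (.cond (fun hb => .set (.set ?_)) fun hb => .skip (.set ?_))
    · simp [he9, harr5, harr8] at hb
      simp [he9]
      exact ⟨by omega, e, he, le_rfl, hb⟩
    · simp [he9, harr5, harr8] at hb
      simp [he9, hI]
      refine ⟨by omega, ?_⟩
      congr 1
      rw [eq_iff_iff]
      constructor
      · rintro ⟨e', h, h', h''⟩
        exact ⟨e', h, h'.le, h''⟩
      · rintro ⟨e', h, h', h''⟩
        exact ⟨e', h, h'.lt_of_ne fun h => hb (h ▸ h''), h''⟩
  · rintro s' t - ⟨ht, -, hI⟩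
    refine ⟨by simp at ht ⊢; omega, ?_⟩
    rw [hI]
    congr 1
    rw [eq_iff_iff]
    constructor
    · rintro ⟨e, h, h', h''⟩
      have := (hadj.lists u hu).sound e h h'
      exact ⟨_, this.1, this.2, h''⟩
    · rintro ⟨w, hw, huw, hw1⟩
      obtain ⟨e, h, h', rfl⟩ := (hadj.lists u hu).complete w hw huw
      exact ⟨e, h, h', hw1⟩

/-- Writes `L` and `R` as a row of the matrix of bicliques, deletes `R` from `S`, and records in
register `11` whether `L` is nonempty. -/
def writeRow : RamProg :=
  .set 6 (reg 2) ;;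
  .set 11 (const 0) ;;
  .set 5 (const 0) ;;
  .loop (.lt (reg 5) (reg 0))
    (.cond (.eq (get 8 (reg 5)) (const 1))
      (.put 1 (reg 6) (const 1) ;; .set 11 (const 1))
      (.cond (.eq (get 2 (reg 5)) (const 0))
        (.put 1 (reg 6) (const 0))
        (scanNbrs ;;
        .put 1 (reg 6) (reg 12) ;;
        .put 2 (reg 5) (sub (const 1) (reg 12)))) ;;
    .set 6 (succ (reg 6)) ;;
    .set 5 (succ (reg 5)))

open Classical in
/-- The potential of the main loop is `80 j + 30 (arr 4 j)`: the list of `j` has length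
`arr 4 (j + 1) - arr 4 j`, so that all lists together are scanned in time linear in their total
length. -/
theorem writeRow_spec {n base : ℕ} {a : ℕ → ℕ → Prop} {S L R : ℕ → Prop} {s : RamStore}
    (h0 : s.reg 0 = n) (hbase : s.reg 2 = base) (hadj : IsAdjList a n (s.arr 4) (s.arr 5))
    (hS : ∀ u < n, s.arr 2 u = if S u then 1 else 0)
    (hL : ∀ u < n, s.arr 8 u = if L u then 1 else 0) (hLS : ∀ u < n, L u → S u)
    (hR : ∀ u < n, (R u ↔ S u ∧ ¬ L u ∧ ∀ w < n, L w → ¬ a u w)) :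
    Halts writeRow s fun s' t => t ≤ 80 * n + 30 * s.arr 4 n + 20 ∧ s'.reg 6 = base + n ∧
      (s'.reg 11 = if ∃ u < n, L u then 1 else 0) ∧
      (∀ c < base, s'.arr 1 c = s.arr 1 c) ∧
      (∀ u < n, s'.arr 1 (base + u) = if L u then 1 else if R u then 2 else 0) ∧
      ∀ u < n, s'.arr 2 u = if S u ∧ ¬ R u then 1 else 0 := by
  refine .seq (.set (.seq (.set (.seq (.set ?_)))))
  refine (Halts.loop_up (fun j s' => s'.reg 6 = base + j ∧
      (s'.reg 11 = if ∃ u < j, L u then 1 else 0) ∧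
      (∀ c < base, s'.arr 1 c = s.arr 1 c) ∧
      (∀ u < j, s'.arr 1 (base + u) = if L u then 1 else if R u then 2 else 0) ∧
      (∀ u < j, s'.arr 2 u = if S u ∧ ¬ R u then 1 else 0) ∧
      ∀ u, j ≤ u → s'.arr 2 u = s.arr 2 u)
    (fun j => 80 * j + 30 * s.arr 4 j) (Nat.zero_le n) (by simp) (by simpa) (by decide)
    ?_ ?_).mono ?_
  · simp [hbase]
  · rintro j - hj s' hs' hj5 ⟨h6, h11, hold, hrow, hlt, hge⟩
    have harr4 : s'.arr 4 = s.arr 4 := hs'.arr 4 (by decide)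
    have harr5 : s'.arr 5 = s.arr 5 := hs'.arr 5 (by decide)
    have harr8 : s'.arr 8 = s.arr 8 := hs'.arr 8 (by decide)
    have hmono := hadj.mono j hj
    have hex : (∃ u < j + 1, L u) ↔ (∃ u < j, L u) ∨ L j := by
      constructor
      · rintro ⟨u, hu, h⟩
        rcases (Nat.le_of_lt_succ hu).lt_or_eq with hu | rfl
        exacts [.inl ⟨u, hu, h⟩, .inr h]
      · rintro (⟨u, hu, h⟩ | h)
        exacts [⟨u, by omega, h⟩, ⟨j, by omega, h⟩]
    have hcode : ∀ c : ℕ, (c = if L j then 1 else if R j then 2 else 0) → ∀ u ≤ j,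
        Function.update (s'.arr 1) (base + j) c (base + u) =
          if L u then 1 else if R u then 2 else 0 := by
      intro c hc u hu
      rcases hu.lt_or_eq with h | rfl
      · rw [Function.update_of_ne (by omega), hrow u h]
      · rw [Function.update_self, hc]
    have hold' : ∀ c d : ℕ, d < base → Function.update (s'.arr 1) (base + j) c d = s.arr 1 d :=
      fun c d hd => by rw [Function.update_of_ne (by omega), hold d hd]
    refine .seq (.cond (fun hb => ?_) fun hb => .cond (fun hb' => ?_) fun hb' => ?_)
    · have hLj : L j := by simpa [hj5, harr8, hL j hj] using hb
      have hRj : ¬ R j := fun h => ((hR j hj).1 h).2.1 hLj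
      refine .seq (.put (.set (.seq (.set (.set ?_)))))
      simp only [hex, hLj, or_true, if_true]
      simp [hj5, h6, add_assoc]
      refine ⟨by omega, hold' 1, hcode 1 (by simp [hLj]), fun u hu => ?_,
        fun u hu => hge u (by omega)⟩
      rcases hu.lt_or_eq with h | rfl
      · exact hlt u h
      · rw [hge u le_rfl, hS u hj]
        simp [hLS u hj hLj, hRj]
    · have hLj : ¬ L j := by simpa [hj5, harr8, hL j hj] using hb
      have hSj : ¬ S j := by simpa [hj5, hge, hS j hj] using hb'
      have hRj : ¬ R j := fun h => hSj ((hR j hj).1 h).1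
      refine .put (.seq (.set (.set ?_)))
      simp only [hex, hLj, or_false]
      simp [hj5, h6, add_assoc, h11]
      refine ⟨by omega, hold' 0, hcode 0 (by simp [hLj, hRj]), fun u hu => ?_,
        fun u hu => hge u (by omega)⟩
      rcases hu.lt_or_eq with h | rfl
      · exact hlt u h
      · rw [hge u le_rfl, hS u hj]
        simp [hSj]
    · have hLj : ¬ L j := by simpa [hj5, harr8, hL j hj] using hb
      have hSj : S j := by simpa [hj5, hge, hS j hj] using hb'
      refine .seq ((scanNbrs_spec (a := a) hj5 hj (by rwa [harr4, harr5])).mono ?_)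
      rintro s₁ t₁ hs₁ ⟨ht₁, h12⟩
      rw [harr4] at ht₁
      have h5₁ : s₁.reg 5 = j := (hs₁.reg 5 (by decide)).trans hj5
      have h6₁ : s₁.reg 6 = base + j := (hs₁.reg 6 (by decide)).trans h6
      have h11₁ : s₁.reg 11 = s'.reg 11 := hs₁.reg 11 (by decide)
      have harr₁ : s₁.arr = s'.arr := by
        funext b
        exact hs₁.arr b (by simp [scanNbrs, RamProg.arrs])
      have h12' : s₁.reg 12 = if R j then 2 else 0 := by
        rw [h12]
        have : (∃ w < n, a j w ∧ s'.arr 8 w = 1) ↔ ¬ R j := by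
          rw [hR j hj, harr8]
          constructor
          · rintro ⟨w, hw, hjw, hw1⟩ ⟨-, -, h⟩
            exact h w hw (by simpa [hL w hw] using hw1) hjw
          · intro h
            by_contra! h'
            exact h ⟨hSj, hLj, fun w hw hLw hjw => h' w hw hjw (by simp [hL w hw, hLw])⟩
        by_cases hRj : R j <;> simp [this, hRj]
      refine .seq (.put (.put (.seq (.set (.set ?_)))))
      simp only [hex, hLj, or_false]
      simp [h5₁, h6₁, h11₁, add_assoc, h11, harr₁]
      refine ⟨by omega, hold' _, hcode _ (by simp [hLj, h12']), fun u hu => ?_, fun u hu => ?_⟩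
      · rcases hu.lt_or_eq with h | rfl
        · rw [Function.update_of_ne h.ne, hlt u h]
        · rw [Function.update_self, h12']
          by_cases hRj : R u <;> simp [hRj, hSj]
      · rw [Function.update_of_ne (by omega), hge u (by omega)]
  · rintro s' t - ⟨ht, -, h6, h11, hold, hrow, hlt, -⟩
    exact ⟨by simp at ht ⊢; omega, h6, h11, hold, hrow, hlt⟩

/-- One iteration of the heuristic.  Register `2` holds the position in array `1` at which the next
biclique is written. -/
def iteration : RamProg :=
  markLeft ;;
  writeRow ;;
  .cond (.eq (reg 11) (const 1)) (.set 1 (succ (reg 1)) ;; .set 2 (reg 6)) .skip ;;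
  findFirst

open Classical in
theorem iteration_spec {n v : ℕ} {a : ℕ → ℕ → Prop} {S L R : ℕ → Prop} {s : RamStore}
    (h0 : s.reg 0 = n) (h3 : s.reg 3 = v) (hv : v < n)
    (hadj : IsAdjList a n (s.arr 4) (s.arr 5))
    (hS : ∀ u < n, s.arr 2 u = if S u then 1 else 0)
    (hL : ∀ u < n, (L u ↔ S u ∧ u ≠ v ∧ ¬ a v u))
    (hR : ∀ u < n, (R u ↔ S u ∧ ¬ L u ∧ ∀ w < n, L w → ¬ a u w)) :
    Halts iteration s fun s' t => t ≤ 140 * n + 60 * s.arr 4 n + 100 ∧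
      (∀ c < s.reg 2, s'.arr 1 c = s.arr 1 c) ∧
      (∀ u < n, s'.arr 1 (s.reg 2 + u) = if L u then 1 else if R u then 2 else 0) ∧
      (∀ u < n, s'.arr 2 u = if S u ∧ ¬ R u then 1 else 0) ∧
      (s'.reg 1 = if ∃ u < n, L u then s.reg 1 + 1 else s.reg 1) ∧
      (s'.reg 2 = if ∃ u < n, L u then s.reg 2 + n else s.reg 2) ∧
      ((s'.reg 3 = n ∧ ∀ i < n, s'.arr 2 (s'.arr 3 i) ≠ 1) ∨
        ∃ i < n, s'.reg 3 = s'.arr 3 i ∧ s'.arr 2 (s'.arr 3 i) = 1 ∧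
          ∀ j < i, s'.arr 2 (s'.arr 3 j) ≠ 1) := by
  refine .seq ((markLeft_spec h0 h3 hv hadj).mono ?_)
  rintro s₁ t₁ hs₁ ⟨ht₁, h8⟩
  have h4₁ : s₁.arr 4 = s.arr 4 := hs₁.arr 4 (by decide)
  have h5₁ : s₁.arr 5 = s.arr 5 := hs₁.arr 5 (by decide)
  have h2₁ : s₁.arr 2 = s.arr 2 := hs₁.arr 2 (by decide)
  have h1₁ : s₁.arr 1 = s.arr 1 := hs₁.arr 1 (by decide)
  refine .seq ((writeRow_spec (n := n) (base := s.reg 2) (a := a) (S := S) (L := L) (R := R)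
    ((hs₁.reg 0 (by decide)).trans h0) (hs₁.reg 2 (by decide)) (by rwa [h4₁, h5₁])
    (by rwa [h2₁]) ?_ (fun u hu h => ((hL u hu).1 h).1) hR).mono ?_)
  · intro u hu
    rw [h8 u hu, hS u hu]
    simp only [hL u hu]
    by_cases huv : u = v <;> by_cases ha : a v u <;> simp [huv, ha]
  rintro s₂ t₂ hs₂ ⟨ht₂, h6, h11, hold, hrow, hrem⟩
  rw [h4₁] at ht₂
  have hr0 : s₂.reg 0 = n := (hs₂.reg 0 (by decide)).trans ((hs₁.reg 0 (by decide)).trans h0)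
  have hr1 : s₂.reg 1 = s.reg 1 := (hs₂.reg 1 (by decide)).trans (hs₁.reg 1 (by decide))
  have hr2 : s₂.reg 2 = s.reg 2 := (hs₂.reg 2 (by decide)).trans (hs₁.reg 2 (by decide))
  rw [h1₁] at hold
  have key : Halts (.cond (.eq (reg 11) (const 1)) (.set 1 (succ (reg 1)) ;; .set 2 (reg 6)) .skip)
      s₂ fun s' t => t ≤ 10 ∧ (s'.reg 1 = if ∃ u < n, L u then s.reg 1 + 1 else s.reg 1) ∧
        (s'.reg 2 = if ∃ u < n, L u then s.reg 2 + n else s.reg 2) := by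
    by_cases hex : ∃ u < n, L u
    · rw [if_pos hex] at h11
      simp only [hex, if_true]
      refine .cond (fun _ => .seq (.set (.set ?_))) fun hb => absurd h11 (by simpa using hb)
      simp [hr1, h6]
    · rw [if_neg hex] at h11
      simp only [hex, if_false]
      refine .cond (fun hb => absurd hb (by simp [h11])) fun _ => .skip ?_
      simp [hr1, hr2]
  refine .seq (key.mono ?_)
  rintro s₃ t₃ hs₃ ⟨ht₃, hr1', hr2'⟩
  refine (findFirst_spec ((hs₃.reg 0 (by decide)).trans hr0)).mono ?_
  rintro s₄ t₄ hs₄ ⟨ht₄, hfirst⟩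
  have harr₃ : s₃.arr = s₂.arr := by
    funext b
    exact hs₃.arr b (by simp [RamProg.arrs])
  have harr₄ : s₄.arr = s₃.arr := by
    funext b
    exact hs₄.arr b (by simp [findFirst, RamProg.arrs])
  have hr1₄ : s₄.reg 1 = s₃.reg 1 := hs₄.reg 1 (by decide)
  have hr2₄ : s₄.reg 2 = s₃.reg 2 := hs₄.reg 2 (by decide)
  rw [← harr₄] at hfirst
  rw [← harr₃, ← harr₄] at hold hrow hrem
  exact ⟨by omega, hold, hrow, hrem, hr1₄.trans hr1', hr2₄.trans hr2', hfirst⟩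

/-! ### From graphs to relations on numbers -/

section Graph

variable {n : ℕ}

/-- The adjacency relation of a graph on `Fin n`, as a relation on numbers. -/
def natAdj (H : SimpleGraph (Fin n)) (i j : ℕ) : Prop :=
  ∃ (hi : i < n) (hj : j < n), H.Adj ⟨i, hi⟩ ⟨j, hj⟩

theorem natAdj_coe {H : SimpleGraph (Fin n)} {i j : Fin n} : natAdj H i j ↔ H.Adj i j :=
  ⟨fun ⟨_, _, h⟩ => h, fun h => ⟨i.2, j.2, h⟩⟩

open Classical in
theorem card_filter_eq_of_coe (P : ℕ → Prop) (F : Finset (Fin n)) (F' : Finset ℕ)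
    (h : ∀ q, q ∈ F' ↔ ∃ hq : q < n, (⟨q, hq⟩ : Fin n) ∈ F) :
    (F.filter fun q : Fin n => P q).card = (F'.filter P).card := by
  rw [← Finset.card_map Fin.valEmbedding]
  congr 1
  ext q
  simp only [Finset.mem_map, Finset.mem_filter, Fin.valEmbedding_apply, h]
  constructor
  · rintro ⟨i, ⟨hi, hP⟩, rfl⟩
    exact ⟨⟨i.2, hi⟩, hP⟩
  · rintro ⟨⟨hq, hF⟩, hP⟩
    exact ⟨⟨q, hq⟩, ⟨hF, hP⟩, rfl⟩

open Classical in
theorem sum_count_natAdj (H : SimpleGraph (Fin n)) :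
    ∑ i ∈ Finset.range n, Nat.count (natAdj H i) n = 2 * H.edgeSet.ncard := by
  rw [Set.ncard_eq_toFinset_card', Set.toFinset_card, ← SimpleGraph.edgeFinset_card,
    ← H.sum_degrees_eq_twice_card_edges, Finset.sum_range]
  refine Finset.sum_congr rfl fun i _ => ?_
  rw [Nat.count_eq_card_filter_range, ← SimpleGraph.card_neighborFinset_eq_degree,
    ← card_filter_eq_of_coe (natAdj H i) (Finset.univ : Finset (Fin n)) (Finset.range n) (by simp)]
  congr 1
  ext j
  simp [natAdj_coe]

/-- A position in the adjacency matrix determines its row and column. -/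
theorem graphInput_arr_eq_zero {G : SimpleGraph (Fin n)} {i j : ℕ} (hi : i < n) (hj : j < n)
    (hij : j ≠ i) : (graphInput G).arr 0 (i * n + j) = 0 ↔ natAdj Gᶜ i j := by
  have key : (∃ i' j' : Fin n, i * n + j = (i' : ℕ) * n + (j' : ℕ) ∧ G.Adj i' j') ↔
      G.Adj ⟨i, hi⟩ ⟨j, hj⟩ := by
    constructor
    · rintro ⟨i', j', h, h'⟩
      have h₁ := congrArg (· / n) h
      have h₂ := congrArg (· % n) h
      simp only [Nat.mul_comm _ n,
        Nat.mul_add_div (Nat.zero_lt_of_lt hi), Nat.div_eq_of_lt hj, Nat.div_eq_of_lt j'.2,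
        Nat.add_zero, Nat.mul_add_mod, Nat.mod_eq_of_lt hj, Nat.mod_eq_of_lt j'.2] at h₁ h₂
      subst h₁ h₂
      exact h'
    · exact fun h => ⟨_, _, rfl, h⟩
  have hne : (⟨i, hi⟩ : Fin n) ≠ ⟨j, hj⟩ := fun h => hij (Fin.mk.inj_iff.1 h).symm
  have : natAdj Gᶜ i j ↔ ¬ G.Adj ⟨i, hi⟩ ⟨j, hj⟩ := by
    unfold natAdj
    simp [hi, hj, hij.symm]
  rw [this, graphInput]
  dsimp only
  split_ifs with h
  · exact iff_of_false (by simp) (not_not.2 (key.1 h.2))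
  · exact iff_of_true rfl fun h' => h ⟨rfl, key.2 h'⟩

open Classical in
/-- A completed search is an ordering by maximum cardinality search. -/
theorem IsSearchSuffix.exists_ordering {H : SimpleGraph (Fin n)} {f : ℕ → ℕ}
    (hf : IsSearchSuffix (natAdj H) n 0 f) :
    ∃ σ : Fin n ≃ Fin n, (∀ i : Fin n, f i = σ i) ∧ IsMaxCardinalityOrdering H σ := by
  have hinj : Function.Injective fun i : Fin n => (⟨f i, hf.lt i (Nat.zero_le _) i.2⟩ : Fin n) := by
    intro i j h
    have h : f i = f j := Fin.mk.inj_iff.1 h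
    rcases lt_trichotomy i j with hij | hij | hij
    · exact absurd h (hf.ne i j (Nat.zero_le _) hij j.2)
    · exact hij
    · exact absurd h.symm (hf.ne j i (Nat.zero_le _) hij i.2)
  refine ⟨Equiv.ofBijective _ (Finite.injective_iff_bijective.1 hinj), fun i => rfl, ?_⟩
  set σ := Equiv.ofBijective _ (Finite.injective_iff_bijective.1 hinj)
  have hσ : ∀ i : Fin n, f i = σ i := fun i => rfl
  have hcard : ∀ i j : Fin n, ((Finset.Ioi i).filter fun q => H.Adj (σ q) (σ j)).card =
      weight (natAdj H) n (i + 1) f (f j) := by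
    intro i j
    unfold weight
    rw [← card_filter_eq_of_coe (fun q => natAdj H (f q) (f j)) (Finset.Ioi i)]
    · congr 1
      ext q
      simp [hσ, natAdj_coe]
    · intro q
      simp only [Finset.mem_Ico, Finset.mem_Ioi, Fin.lt_def]
      exact ⟨fun h => ⟨h.2, h.1⟩, fun ⟨h, h'⟩ => ⟨h', h⟩⟩
  intro i j hji
  have hlt : (j : ℕ) < i := hji
  convert hf.max i (Nat.zero_le _) i.2 (f j) (hf.lt j (Nat.zero_le _) j.2)
    (fun q hq hqn => (hf.ne j q (Nat.zero_le _) (by omega) hqn).symm) using 1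
  · convert hcard i j
  · convert hcard i i

end Graph

/-! ### The whole program -/

/-- The preparation: adjacency lists of the complement, the ordering, and the first vertex. -/
def prepare : RamProg :=
  buildLists ;;
  search ;;
  findFirst

/-- The memory at the head of the main loop: besides the state of the heuristic it holds the
adjacency lists of the complement, the position for the next biclique, and the vertex that the next
iteration starts from (or `n` if no vertex remains). -/
structure IsLoopHead {n : ℕ} (H : SimpleGraph (Fin n)) (σ : Fin n ≃ Fin n)
    (A : HeuristicState (Fin n)) (s : RamStore) : Prop where
  state : HoldsState σ A s
  size : s.reg 0 = n
  position : s.reg 2 = A.bp.length * n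
  lists : IsAdjList (natAdj H) n (s.arr 4) (s.arr 5)
  length : s.arr 4 n = 2 * H.edgeSet.ncard
  first : (s.reg 3 = n ∧ A.S = ∅) ∨
    ∃ v ∈ A.S, s.reg 3 = v ∧ ∀ u ∈ A.S, σ.symm v ≤ σ.symm u

section Program

variable {n : ℕ} {G : SimpleGraph (Fin n)} {σ : Fin n ≃ Fin n} {A : HeuristicState (Fin n)}
  {s : RamStore}

/-- The search for the first marked position of the ordering finds the first vertex of `S`. -/
theorem first_of_findFirst (h : HoldsState σ A s)
    (hf : (s.reg 3 = n ∧ ∀ i < n, s.arr 2 (s.arr 3 i) ≠ 1) ∨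
      ∃ i < n, s.reg 3 = s.arr 3 i ∧ s.arr 2 (s.arr 3 i) = 1 ∧
        ∀ j < i, s.arr 2 (s.arr 3 j) ≠ 1) :
    (s.reg 3 = n ∧ A.S = ∅) ∨
      ∃ v ∈ A.S, s.reg 3 = v ∧ ∀ u ∈ A.S, σ.symm v ≤ σ.symm u := by
  have hmem : ∀ i : Fin n, s.arr 2 (s.arr 3 i) = 1 ↔ σ i ∈ A.S := by
    intro i
    rw [h.order, h.remaining]
    split_ifs with hi <;> simp [hi]
  rcases hf with ⟨h3, hf⟩ | ⟨i, hi, h3, h1, hf⟩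
  · refine .inl ⟨h3, Finset.eq_empty_of_forall_notMem fun u hu => ?_⟩
    refine hf _ (σ.symm u).2 ((hmem _).2 ?_)
    simpa using hu
  · refine .inr ⟨σ ⟨i, hi⟩, (hmem ⟨i, hi⟩).1 h1, h3.trans (h.order ⟨i, hi⟩), fun u hu => ?_⟩
    rw [σ.symm_apply_apply]
    by_contra! hlt
    exact hf (σ.symm u) hlt ((hmem _).2 (by simpa using hu))

open Classical in
theorem prepare_spec (G : SimpleGraph (Fin n)) :
    Halts prepare (graphInput G) fun s t => t ≤ 300 * (n * n) + 100 ∧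
      ∃ σ : Fin n ≃ Fin n, IsMaxCardinalityOrdering Gᶜ σ ∧
        IsLoopHead Gᶜ σ ⟨Finset.univ, []⟩ s := by
  have ha : ∀ i < n, ∀ j < n, j ≠ i →
      ((graphInput G).arr 0 (i * n + j) = 0 ↔ natAdj Gᶜ i j) :=
    fun i hi j hj hij => graphInput_arr_eq_zero hi hj hij
  refine .seq ((buildLists_spec (n := n) (a := natAdj Gᶜ) (by simp [graphInput])
    (by simp [graphInput]) (by simp [graphInput]) (by simp [graphInput])
    (fun i ⟨_, _, h⟩ => h.ne rfl) ha).mono ?_)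
  rintro s₁ t₁ hs₁ ⟨ht₁, hrow, hlen, hadj⟩
  refine .seq ((search_spec (n := n) (a := natAdj Gᶜ)
    ((hs₁.reg 0 (by decide)).trans (by simp [graphInput]))
    (fun u _ => by rw [hs₁.arr 2 (by decide)]; simp [graphInput]) hrow
    (fun u _ => by rw [hs₁.arr 7 (by decide)]; simp [graphInput])
    (by rwa [hs₁.arr 0 (by decide)])).mono ?_)
  rintro s₂ t₂ hs₂ ⟨ht₂, hf, hall⟩
  have h0₂ : s₂.reg 0 = n := by
    rw [hs₂.reg 0 (by decide), hs₁.reg 0 (by decide)]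
    simp [graphInput]
  refine (findFirst_spec h0₂).mono ?_
  rintro s₃ t₃ hs₃ ⟨ht₃, hfirst⟩
  have harr₃ : s₃.arr = s₂.arr := by
    funext b
    exact hs₃.arr b (by simp [findFirst, RamProg.arrs])
  obtain ⟨σ, hσ, hmcs⟩ := hf.exists_ordering
  have hstate : HoldsState σ ⟨Finset.univ, []⟩ s₃ := by
    refine ⟨?_, fun i => i.elim0, fun u => ?_, fun i => ?_⟩
    · rw [hs₃.reg 1 (by decide), hs₂.reg 1 (by decide), hs₁.reg 1 (by decide)]
      simp [graphInput]
    · rw [harr₃, hall u u.2 ⟨σ.symm u, (σ.symm u).2, by simp [hσ]⟩]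
      simp
    · rw [harr₃, hσ]
  refine ⟨?_, σ, hmcs, hstate, ?_, ?_, ?_, ?_, first_of_findFirst hstate ?_⟩
  · have := Nat.le_mul_self n
    linarith
  · rw [hs₃.reg 0 (by decide), h0₂]
  · rw [hs₃.reg 2 (by decide), hs₂.reg 2 (by decide), hs₁.reg 2 (by decide)]
    simp [graphInput]
  · rwa [harr₃, hs₂.arr 4 (by decide), hs₂.arr 5 (by decide)]
  · rw [harr₃, hs₂.arr 4 (by decide), hlen, sum_count_natAdj]
  · rwa [harr₃]

open Classical in
/-- The body of the main loop performs one iteration of the heuristic. -/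
theorem IsLoopHead.iterate (h : IsLoopHead Gᶜ σ A s) (hS : A.S ≠ ∅) :
    ∃ A' s' t, HeuristicIteration Gᶜ σ A A' ∧ A'.S ⊂ A.S ∧ RamExec iteration s s' t ∧
      t ≤ 240 * (n + Gᶜ.edgeSet.ncard) ∧ IsLoopHead Gᶜ σ A' s' := by
  obtain ⟨-, h'⟩ | ⟨v, hv, h3, hmin⟩ := h.first
  · exact absurd h' hS
  set L := leftPart Gᶜ A.S v with hL
  set R := rightPart Gᶜ A.S v with hR
  -- sets of vertices as predicates on numbers
  let toNat : Finset (Fin n) → ℕ → Prop := fun F u => ∃ hu : u < n, (⟨u, hu⟩ : Fin n) ∈ F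
  have htoNat : ∀ (F : Finset (Fin n)) (u : Fin n), toNat F u ↔ u ∈ F :=
    fun F u => ⟨fun ⟨_, h⟩ => h, fun h => ⟨u.2, h⟩⟩
  obtain ⟨s', t, he, ht, hold, hrow, hrem, hr1, hr2, hfirst⟩ := iteration_spec (n := n) (v := v)
    (a := natAdj Gᶜ) (S := toNat A.S) (L := toNat L) (R := toNat R) h.size h3 v.2 h.lists
    (fun u hu => by
      have := h.state.remaining ⟨u, hu⟩
      have h' := htoNat A.S ⟨u, hu⟩
      simp only at this h'
      rw [this]
      simp only [h'])
    (fun u hu => by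
      lift u to Fin n using hu
      rw [htoNat, htoNat, natAdj_coe, hL, mem_leftPart, Fin.val_inj.ne])
    (fun u hu => by
      lift u to Fin n using hu
      rw [htoNat, htoNat, htoNat, hR, mem_rightPart hv]
      refine and_congr_right' (and_congr_right' ⟨fun h w hw hwL => ?_, fun h w hwL => ?_⟩)
      · lift w to Fin n using hw
        rw [natAdj_coe]
        exact h w ((htoNat _ _).1 hwL)
      · rw [← natAdj_coe]
        exact h w w.2 ((htoNat _ _).2 hwL))
  have hF := he.frame
  have hr0 : s'.reg 0 = n := (hF.reg 0 (by decide)).trans h.size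
  have h3' : s'.arr 3 = s.arr 3 := hF.arr 3 (by decide)
  have h4' : s'.arr 4 = s.arr 4 := hF.arr 4 (by decide)
  have h5' : s'.arr 5 = s.arr 5 := hF.arr 5 (by decide)
  have hLne : (∃ u < n, toNat L u) ↔ L ≠ ∅ := by
    rw [← Finset.nonempty_iff_ne_empty]
    exact ⟨fun ⟨u, _, _, h⟩ => ⟨_, h⟩, fun ⟨u, h⟩ => ⟨u, u.2, u.2, h⟩⟩
  rw [h.position] at hold hrow hr2
  rw [h.state.count] at hr1
  have hold' : ∀ (i : Fin A.bp.length) (u : Fin n), s'.arr 1 ((i : ℕ) * n + u) =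
      if u ∈ A.bp[i].1 then 1 else if u ∈ A.bp[i].2 then 2 else 0 := by
    intro i u
    have : ((i : ℕ) + 1) * n ≤ A.bp.length * n := Nat.mul_le_mul_right n i.2
    rw [hold _ (by have := u.2; linarith), h.state.bicliques]
  have hrem' : ∀ u : Fin n, s'.arr 2 u = if u ∈ A.S \ R then 1 else 0 := by
    intro u
    rw [hrem u u.2]
    simp only [htoNat, Finset.mem_sdiff]
  have hstep : HeuristicIteration Gᶜ σ A
      ⟨A.S \ R, if L = ∅ then A.bp else A.bp ++ [(L, R)]⟩ := ⟨v, hv, hmin, by convert rfl, by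
        rw [hL, hR]
        split_ifs <;> rfl⟩
  have hsub : A.S \ R ⊂ A.S := by
    rw [Finset.ssubset_iff_of_subset Finset.sdiff_subset]
    exact ⟨v, hv, by simp [hR, mem_rightPart_self]⟩
  have htime : t ≤ 240 * (n + Gᶜ.edgeSet.ncard) := by
    have := v.pos
    rw [h.length] at ht
    omega
  refine ⟨_, s', t, hstep, hsub, he, htime, ?_⟩
  have hstate : HoldsState σ ⟨A.S \ R, if L = ∅ then A.bp else A.bp ++ [(L, R)]⟩ s' := by
    by_cases hL0 : L = ∅
    · simp only [hL0, if_true]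
      refine ⟨?_, hold', fun u => ?_, fun i => by rw [h3', h.state.order]⟩
      · rw [hr1, if_neg (by simpa [hLne] using hL0)]
      · convert hrem' u
    · simp only [hL0, if_false]
      refine ⟨?_, fun i u => ?_, fun u => ?_, fun i => by rw [h3', h.state.order]⟩
      · rw [hr1, if_pos (by simpa [hLne] using hL0)]
        simp
      · obtain ⟨i, hi⟩ := i
        have hi' : i < A.bp.length + 1 := by simpa using hi
        rcases (Nat.le_of_lt_succ hi').lt_or_eq with hlt | rfl
        · have := hold' ⟨i, hlt⟩ u
          simpa [List.getElem_append_left hlt] using this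
        · have := hrow u u.2
          simp only [htoNat] at this
          simpa using this
      · convert hrem' u
  refine ⟨hstate, hr0, ?_, by rw [h4', h5']; exact h.lists, by rw [h4', h.length],
    first_of_findFirst hstate hfirst⟩
  by_cases hL0 : L = ∅
  · simp only [hL0, if_true]
    rw [hr2, if_neg (by simpa [hLne] using hL0)]
  · simp only [hL0, if_false]
    rw [hr2, if_pos (by simpa [hLne] using hL0)]
    simp [Nat.succ_mul]

/-- The test of the main loop. -/
def remains : RamTest := .lt (reg 3) (reg 0)

theorem IsLoopHead.remains_holds_iff {H : SimpleGraph (Fin n)} (h : IsLoopHead H σ A s) :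
    remains.Holds s ↔ A.S ≠ ∅ := by
  rcases h.first with ⟨h3, hS⟩ | ⟨v, hv, h3, -⟩
  · simp [remains, h3, h.size, hS]
  · simp [remains, h3, h.size, Finset.ne_empty_of_mem hv]

/-- From the head of the main loop, with at most `m` vertices remaining, the heuristic ends after at
most `m` iterations, and the machine follows it. -/
theorem IsLoopHead.exists_run (m : ℕ) : ∀ {A₀ : HeuristicState (Fin n)} {s₀ : RamStore},
    IsLoopHead Gᶜ σ A₀ s₀ → A₀.S.card ≤ m →
    ∃ (k : ℕ) (A : ℕ → HeuristicState (Fin n)) (s : ℕ → RamStore) (t : ℕ → ℕ) (T : ℕ),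
      A 0 = A₀ ∧ s 0 = s₀ ∧ (∀ i ≤ k, IsLoopHead Gᶜ σ (A i) (s i)) ∧
      (∀ i < k, (A i).S ≠ ∅ ∧ HeuristicIteration Gᶜ σ (A i) (A (i + 1)) ∧
        RamExec iteration (s i) (s (i + 1)) (t i) ∧ t i ≤ 240 * (n + Gᶜ.edgeSet.ncard)) ∧
      (A k).S = ∅ ∧ RamExec (.loop remains iteration) s₀ (s k) T ∧
      T ≤ m * (240 * (n + Gᶜ.edgeSet.ncard) + 3) + 3 := by
  induction m with
  | zero =>
    intro A₀ s₀ h hm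
    have hS : A₀.S = ∅ := Finset.card_eq_zero.1 (Nat.le_zero.1 hm)
    exact ⟨0, fun _ => A₀, fun _ => s₀, fun _ => 0, _, rfl, rfl, fun _ _ => h, by simp, hS,
      .loop_false (mt h.remains_holds_iff.1 (not_not.2 hS)), by simp [remains]⟩
  | succ m ih =>
    intro A₀ s₀ h hm
    by_cases hS : A₀.S = ∅
    · exact ⟨0, fun _ => A₀, fun _ => s₀, fun _ => 0, _, rfl, rfl, fun _ _ => h, by simp, hS,
        .loop_false (mt h.remains_holds_iff.1 (not_not.2 hS)), by simp [remains]⟩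
    obtain ⟨A₁, s₁, t₁, hstep, hsub, he, ht, h₁⟩ := h.iterate hS
    obtain ⟨k, A, s, t, T, hA, hs, hhead, hiter, hk, hloop, hT⟩ := ih h₁ (by
      have := Finset.card_lt_card hsub
      omega)
    refine ⟨k + 1, fun i => i.casesOn A₀ A, fun i => i.casesOn s₀ s, fun i => i.casesOn t₁ t, _,
      rfl, rfl, ?_, ?_, hk, .loop_true (h.remains_holds_iff.2 hS) he hloop, ?_⟩
    · rintro (_ | i) hi
      · exact h
      · exact hhead i (by omega)
    · rintro (_ | i) hi
      · exact ⟨hS, by simpa [hA] using hstep, by simpa [hs] using he, ht⟩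
      · exact hiter i (by omega)
    · simp only [remains, RamTest.cost, RamExp.cost]
      linarith

end Program

end CochordalProgram

open CochordalProgram in
theorem mainTheorem6 :
    ∃ (prep body : RamProg) (b : RamTest) (C : ℕ),
      ∀ (n : ℕ) (G : SimpleGraph (Fin n)), IsChordalGraph Gᶜ →
        ∃ (σ : Fin n ≃ Fin n) (k : ℕ) (A : ℕ → HeuristicState (Fin n)) (s : ℕ → RamStore)
          (t₀ T : ℕ) (t : ℕ → ℕ),
          IsHeuristicRun G σ k A ∧
          IsBicliquePartition G (A k).bp ∧
          (∀ i ≤ k, HoldsState σ (A i) (s i)) ∧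
          RamExec prep (graphInput G) (s 0) t₀ ∧
          (∀ i < k, RamExec body (s i) (s (i + 1)) (t i) ∧
            t i ≤ C * (n + Gᶜ.edgeSet.ncard)) ∧
          RamExec (.seq prep (.loop b body)) (graphInput G) (s k) T ∧
          T ≤ C * (n * (n + Gᶜ.edgeSet.ncard) + 1) := by
  refine ⟨prepare, iteration, remains, 600, fun n G hG => ?_⟩
  obtain ⟨s₀, t₀, he, ht₀, σ, hσ, h₀⟩ := prepare_spec G
  obtain ⟨k, A, s, t, T, hA, hs, hhead, hiter, hk, hloop, hT⟩ :=
    h₀.exists_run n (by simp)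
  have hrun : IsHeuristicRun G σ k A :=
    ⟨hσ.isPerfectElimination hG, hA, fun i hi => ⟨(hiter i hi).1, (hiter i hi).2.1⟩, hk⟩
  refine ⟨σ, k, A, s, t₀, t₀ + T, t, hrun, hrun.isBicliquePartition, fun i hi => (hhead i hi).state,
    by rwa [hs], fun i hi => ⟨(hiter i hi).2.2.1, (hiter i hi).2.2.2.trans ?_⟩,
    .seq he hloop, ?_⟩
  · gcongr
    norm_num
  · have h₁ := Nat.le_mul_self n
    have h₂ := Nat.zero_le (n * Gᶜ.edgeSet.ncard)
    linarith
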